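/- Graphs are finite and simple. In a graph whose vertices are coloured black or white, the colour-change rule says: if a black vertex has exactly one white neighbour, that neighbour becomes black. A set $Z$ of vertices is a zero forcing set if, starting with exactly the vertices of $Z$ black, repeated application of the rule makes all vertices black; $Z(G)$ is the minimum size of a zero forcing set of $G$. For $n\ge 0$ let $L_n$ be the ladder with $n$ squares: vertices $a_0,\dots,a_n,b_0,\dots,b_n$ and edges $a_ib_i$ $(0\le i\le n)$, $a_ia_{i+1}$, $b_ib_{i+1}$ $(0\le i<n)$. We mark some vertices "yellow" and some "white" (a marking unrelated to the forcing process). * $M_n$ is $L_n$ together with two new vertices $p,q$ and the edges $a_np$, $pq$; the vertices $a_0,b_0$ are yellow and the vertices $b_n,p,q$ are white. (So $M_0\cong P_4$; there $b_0$ carries both marks.) * $T_n$ is $L_n$ together with a new vertex $c$ and the edges $a_nc$, $b_nc$; the vertices $a_0,b_0,c$ are yellow and no vertex is white. (So $T_0\cong K_3$.) For a marked graph $G$, let $B(G)$ be the set of vertices that are yellow or have degree $1$ in $G$, and let $A(G)$ be the set of white vertices. The graph $K_1\blacktriangle G$ consists of $G$ and a new vertex adjacent to all vertices of $B(G)$;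 its white vertices are those of $G$. For disjoint marked graphs $G_1,G_2$ with $|A(G_1)|=|B(G_2)|$, the compound $G_1\uplus G_2$ denotes the family of all graphs obtained from the disjoint union of $G_1$ and $G_2$ by adding the edges $uf(u)$, $u\in A(G_1)$, for some bijection $f:A(G_1)\to B(G_2)$; the white vertices of such a graph are those of $G_2$. Expressions in $\blacktriangle$ and $\uplus$ are evaluated from left to right, each $\uplus$ being formed with every member of the family on its left. **Theorem.** Let $G$ be a cubic graph. Then $Z(G)=3$ if and only if (i) $G\cong K_1\blacktriangle T_m$ for some integer $m\ge 0$, or (ii) $G$ is isomorphic to a member of the family $K_1\blacktriangle M_{n_1}\uplus M_{n_2}\uplus\cdots\uplus M_{n_t}\uplus T_m$ for some $t\ge 1$ and some integers $n_1,\dots,n_t,m\ge 0$. -/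

import Mathlib

/-- One application of the colour-change rule: `B` is the set of black vertices, `u` is a black
vertex whose only white neighbour is `v`, and `v` becomes black. -/
def ColorChange {V : Type*} (G : SimpleGraph V) (B B' : Set V) : Prop :=
  ∃ u v, u ∈ B ∧ v ∉ B ∧ G.Adj u v ∧ (∀ w, G.Adj u w → w ∉ B → w = v) ∧ B' = insert v B

/-- `Z` is a zero forcing set: starting from exactly `Z` black, repeated application of the
colour-change rule makes all vertices black. -/
def IsZeroForcingSet {V : Type*} (G : SimpleGraph V) (Z : Set V) : Prop :=
  Relation.ReflTransGen (ColorChange G) Z Set.univ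

/-- The zero forcing number of a finite graph (the full vertex set is always zero forcing, so the
infimum is a minimum). -/
noncomputable def zeroForcingNumber {V : Type*} [Fintype V] (G : SimpleGraph V) : ℕ :=
  sInf {k | ∃ Z : Finset V, Z.card = k ∧ IsZeroForcingSet G (Z : Set V)}

/-- A graph with some vertices marked yellow and some marked white. -/
structure ColoredGraph where
  V : Type
  graph : SimpleGraph V
  yellow : Set V
  white : Set V

namespace ColoredGraph

/-- The vertices at which something is attached from the left: yellow vertices and
pendant vertices (vertices of degree one). -/
def attach (G : ColoredGraph) : Set G.V :=
  {v | v ∈ G.yellow ∨ (G.graph.neighborSet v).ncard = 1}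

/-- `K₁ ▲ G`: a copy of `G` and a new vertex adjacent to all yellow and all pendant vertices of
`G`. White vertices stay white; the yellow marks have been used and are dropped. -/
def cone (G : ColoredGraph) : ColoredGraph where
  V := Unit ⊕ G.V
  graph := ((⊥ : SimpleGraph Unit) ⊕g G.graph) ⊔
    SimpleGraph.fromRel fun x y => x = Sum.inl () ∧ ∃ v ∈ G.attach, y = Sum.inr v
  yellow := ∅
  white := Sum.inr '' G.white

/-- The member of the family `G₁ ⊎ G₂` given by a bijection `f` from the white vertices of `G₁` to
the yellow or pendant vertices of `G₂`: the disjoint union with every edge `u — f u` added.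
The white marks of `G₁` and the yellow marks of `G₂` have been used and are dropped, so the white
vertices of the result are those of `G₂` and its yellow vertices those of `G₁`. -/
def compound (G₁ G₂ : ColoredGraph) (f : G₁.white ≃ G₂.attach) : ColoredGraph where
  V := G₁.V ⊕ G₂.V
  graph := (G₁.graph ⊕g G₂.graph) ⊔
    SimpleGraph.fromRel fun x y => ∃ u : G₁.white, x = Sum.inl u.1 ∧ y = Sum.inr (f u).1
  yellow := Sum.inl '' G₁.yellow
  white := Sum.inr '' G₂.white

/-- The family of all compounds of a member of the family `S` with `H`, over all bijections. -/
def compoundFamily (S : Set ColoredGraph) (H : ColoredGraph) : Set ColoredGraph :=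
  {K | ∃ G ∈ S, ∃ f : G.white ≃ H.attach, K = G.compound H f}

end ColoredGraph

/-- The ladder with `n` squares, i.e. with two rows of `n + 1` vertices and `n + 1` rungs; the
vertex `(i, j)` is in row `i` and column `j`. -/
def ladder (n : ℕ) : SimpleGraph (Fin 2 × Fin (n + 1)) :=
  SimpleGraph.boxProd (SimpleGraph.pathGraph 2) (SimpleGraph.pathGraph (n + 1))

/-- `Mₙ`: the ladder with `n` squares and a path `(0, n) — inr 0 — inr 1` hanging from its corner
`(0, n)`. The two vertices of the first rung are yellow; the corner `(1, n)` and the two path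
vertices are white. `M₀` is the path `P₄`; its end `(1, 0)` is pendant and white (whether one also
calls it yellow is immaterial, as `attach` contains all pendant vertices). -/
def graphM (n : ℕ) : ColoredGraph where
  V := (Fin 2 × Fin (n + 1)) ⊕ Fin 2
  graph := (ladder n ⊕g SimpleGraph.pathGraph 2) ⊔
    SimpleGraph.edge (Sum.inl (0, Fin.last n)) (Sum.inr 0)
  yellow := {Sum.inl (0, 0), Sum.inl (1, 0)}
  white := {Sum.inl (1, Fin.last n), Sum.inr 0, Sum.inr 1}

/-- `Tₙ`: the ladder with `n` squares and an apex adjacent to both vertices of its last rung. The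
two vertices of the first rung and the apex are yellow, nothing is white. `T₀` is `K₃`. -/
def graphT (n : ℕ) : ColoredGraph where
  V := (Fin 2 × Fin (n + 1)) ⊕ Unit
  graph := (ladder n ⊕g (⊥ : SimpleGraph Unit)) ⊔
    SimpleGraph.edge (Sum.inl (0, Fin.last n)) (Sum.inr ()) ⊔
    SimpleGraph.edge (Sum.inl (1, Fin.last n)) (Sum.inr ())
  yellow := {Sum.inl (0, 0), Sum.inl (1, 0), Sum.inr ()}
  white := ∅

/-- The family `K₁ ▲ M_{n₁} ⊎ … ⊎ M_{n_t} ⊎ T_m`, with the operations performed from left to right,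
for the nonempty list `n₁ :: [n₂, …, n_t]`. -/
def chainFamily (n₁ : ℕ) (ns : List ℕ) (m : ℕ) : Set ColoredGraph :=
  ColoredGraph.compoundFamily
    (ns.foldl (fun S n => ColoredGraph.compoundFamily S (graphM n)) {(graphM n₁).cone})
    (graphT m)

/-! The proof follows the number of edges leaving the black set. In a cubic graph, adding a vertex
with `d` neighbours in the set changes this number by `3 - 2d`. Every proper superset of a zero
forcing set still contains a vertex that can force, and this makes a cut of one or two edges
impossible: a proper superset is left by at least three edges (`Forces.eq_univ_of_cutSize_lt`).

Suppose `Z` has three vertices. The first forcing vertex `u` has two neighbours in `Z`, so `Z` is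
`u` with these two (`Forces.exists_star`). Now consider any region `R`, at first `{u}`, left by
three edges with distinct ends `x, y, z`, and blacken these ends. If they are independent, each has
two white neighbours and nothing forces. Two edges among them give a cut of size two. A triangle
exhausts the graph and is `T_0`. So otherwise there is one edge, the first rung of a ladder, and the
third vertex `c` has two white neighbours. From then on only the ends of the last rung can force.
Their new neighbours are distinct, and either they form the next rung or one of them is adjacent to
`c`. In the latter case three edges leave again. If their ends coincide, the graph closes up with
some `T_m`. If not, the ends are distinct, an `M_n` with `q = c` has been split off, and the
argument repeats from the larger region (`LadderState.continues`, `Boundary.continues`,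
`IsPrefix.exists_chain`).

Conversely, take the cone apex and two of its neighbours. The apex forces the third. Once its
attachment vertices are black, each piece blackens rung by rung, and its white vertices then force
the attachment vertices of the next piece (`SpreadsFrom.compound`). Fewer than three vertices never
suffice (`three_le_card_of_forces`). -/

open Finset

/-! ### Forcing and edge cuts in cubic graphs. -/

section Forcing

variable {V : Type*} (G : SimpleGraph V)

/-- A set of vertices is closed under forcing if the colour-change rule does not apply to it. -/
def IsForcingClosed (B : Set V) : Prop :=
  ∀ v ∈ B, ∀ w, G.Adj v w → (∀ w', G.Adj v w' → w' ≠ w → w' ∈ B) → w ∈ B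

/-- A closed superset of `Z` contains every set reachable from `Z`. With the converse below, this
replaces sequences of forces by closed supersets. -/
theorem IsZeroForcingSet.eq_univ {G : SimpleGraph V} {Z B : Set V} (h : IsZeroForcingSet G Z)
    (hZ : Z ⊆ B) (hB : IsForcingClosed G B) : B = Set.univ := by
  have key : ∀ C, Relation.ReflTransGen (ColorChange G) Z C → C ⊆ B := by
    intro C hC
    induction hC with
    | refl => exact hZ
    | tail _ hst ih =>
      obtain ⟨u, v, hu, hv, huv, hw, rfl⟩ := hst
      refine Set.insert_subset ?_ ih
      refine hB u (ih hu) v huv fun w' h1 h2 => ?_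
      by_contra h3
      exact h2 (hw w' h1 fun h4 => h3 (ih h4))
  exact Set.univ_subset_iff.1 (key _ h)

/-- A maximal reachable set is closed, since any applicable force would enlarge it. -/
theorem isZeroForcingSet_of_forall_closed [Finite V] {G : SimpleGraph V} {Z : Set V}
    (h : ∀ B, Z ⊆ B → IsForcingClosed G B → B = Set.univ) : IsZeroForcingSet G Z := by
  obtain ⟨B, hB⟩ := (Set.toFinite {B | Relation.ReflTransGen (ColorChange G) Z B}).exists_maximal
    ⟨Z, Relation.ReflTransGen.refl⟩
  have hZB : Z ⊆ B := by
    have key : ∀ C, Relation.ReflTransGen (ColorChange G) Z C → Z ⊆ C := by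
      intro C hC
      induction hC with
      | refl => exact subset_rfl
      | tail _ hst ih =>
        obtain ⟨u, v, hu, hv, huv, hw, rfl⟩ := hst
        exact ih.trans (Set.subset_insert _ _)
    exact key _ hB.1
  have hcl : IsForcingClosed G B := by
    intro v hv w hvw hw
    by_contra hwB
    have hstep : ColorChange G B (insert w B) :=
      ⟨v, w, hv, hwB, hvw, fun w' h1 h2 => by_contra fun h3 => h2 (hw w' h1 h3), rfl⟩
    have h1 : Relation.ReflTransGen (ColorChange G) Z (insert w B) := hB.1.tail hstep
    exact hwB (hB.2 h1 (Set.subset_insert _ _) (Set.mem_insert _ _))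
  have := h B hZB hcl
  have h2 := hB.1
  rw [this] at h2
  exact h2

variable [Fintype V] [DecidableEq V] [DecidableRel G.Adj]

/-- The neighbours of `v` outside `B`. -/
def outNbrs (B : Finset V) (v : V) : Finset V := G.neighborFinset v \ B

/-- The number of edges leaving `B`. -/
def cutSize (B : Finset V) : ℕ := ∑ v ∈ B, #(outNbrs G B v)

variable {G}

@[simp] theorem mem_outNbrs {B : Finset V} {v w : V} :
    w ∈ outNbrs G B v ↔ G.Adj v w ∧ w ∉ B := by
  simp [outNbrs]

theorem outNbrs_insert (B : Finset V) (v w : V) :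
    outNbrs G (insert w B) v = (outNbrs G B v).erase w := by
  ext x
  simp only [mem_outNbrs, mem_insert, mem_erase]
  tauto

theorem cutSize_univ : cutSize G univ = 0 := by
  simp [cutSize, outNbrs]

theorem ne_univ_of_cutSize {B : Finset V} (h : cutSize G B ≠ 0) : B ≠ univ := by
  rintro rfl
  exact h cutSize_univ

theorem card_outNbrs_self (hG : G.IsRegularOfDegree 3) (B : Finset V) (w : V) :
    #(outNbrs G (insert w B) w) + #(G.neighborFinset w ∩ B) = 3 := by
  have h1 : outNbrs G (insert w B) w = G.neighborFinset w \ B := by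
    rw [outNbrs_insert, erase_eq_of_notMem (by simp)]
    rfl
  rw [h1, card_sdiff_add_card_inter, G.card_neighborFinset_eq_degree, hG w]

/-- The edges from `w` into `B` stop leaving and the other edges at `w` begin to leave. The additive
form avoids natural subtraction. -/
theorem cutSize_insert (hG : G.IsRegularOfDegree 3) {B : Finset V} {w : V} (hw : w ∉ B) :
    cutSize G (insert w B) + 2 * #(G.neighborFinset w ∩ B) = cutSize G B + 3 := by
  have h1 : cutSize G B = ∑ v ∈ B, #(outNbrs G (insert w B) v) + #(G.neighborFinset w ∩ B) := by
    have h2 : G.neighborFinset w ∩ B = B.filter fun v => G.Adj v w := by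
      ext x
      simp [G.adj_comm, and_comm]
    rw [h2, card_filter, ← sum_add_distrib]
    refine sum_congr rfl fun v _ => ?_
    rw [outNbrs_insert, card_erase_eq_ite]
    split_ifs with h3 h4 h4
    · have : 0 < #(outNbrs G B v) := card_pos.2 ⟨w, h3⟩
      omega
    · exact absurd (mem_outNbrs.1 h3).1 h4
    · exact absurd (mem_outNbrs.2 ⟨h4, hw⟩) h3
    · rfl
  have h3 := card_outNbrs_self hG B w
  rw [h1]
  unfold cutSize
  rw [sum_insert hw]
  omega

theorem sum_three_le {ι : Type*} [DecidableEq ι] {s : Finset ι} (f : ι → ℕ) {a b c : ι} (ha : a ∈ s)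
    (hb : b ∈ s) (hc : c ∈ s) (hab : a ≠ b) (hac : a ≠ c) (hbc : b ≠ c) :
    f a + f b + f c ≤ ∑ i ∈ s, f i := by
  have h : ({a, b, c} : Finset ι) ⊆ s := by
    simp [insert_subset_iff, ha, hb, hc]
  have := sum_le_sum_of_subset (f := f) h
  rw [sum_insert (by simp [hab, hac]), sum_insert (by simp [hbc]), sum_singleton] at this
  omega

/-- Every proper superset of `Z` contains a vertex that can force. -/
def Forces (G : SimpleGraph V) [DecidableRel G.Adj] (Z : Finset V) : Prop :=
  ∀ B, Z ⊆ B → (∀ v ∈ B, #(outNbrs G B v) ≠ 1) → B = univ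

theorem IsZeroForcingSet.forces {Z : Finset V} (h : IsZeroForcingSet G (Z : Set V)) :
    Forces G Z := by
  intro B hZ hB
  have := h.eq_univ (B := (B : Set V)) (by exact_mod_cast hZ) ?_
  · exact_mod_cast this
  · intro v hv w hvw hw
    by_contra hwB
    refine hB v (by exact_mod_cast hv) (card_eq_one.2 ⟨w, ?_⟩)
    ext x
    simp only [mem_outNbrs, mem_singleton]
    constructor
    · rintro ⟨h1, h2⟩
      by_contra h3
      exact h2 (by exact_mod_cast hw x h1 h3)
    · rintro rfl
      exact ⟨hvw, by exact_mod_cast hwB⟩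

theorem Forces.exists_force {Z B : Finset V} (h : Forces G Z) (hZ : Z ⊆ B) (hB : B ≠ univ) :
    ∃ v ∈ B, ∃ w ∉ B, G.Adj v w ∧ outNbrs G B v = {w} := by
  by_contra! hcon
  refine hB (h B hZ fun v hv h1 => ?_)
  obtain ⟨w, hw⟩ := card_eq_one.1 h1
  have h2 : w ∈ outNbrs G B v := by simp [hw]
  rw [mem_outNbrs] at h2
  exact hcon v hv w h2.2 h2.1 hw

theorem card_inter_le_cutSize {B : Finset V} {w : V} (hw : w ∉ B) :
    #(G.neighborFinset w ∩ B) ≤ cutSize G B := by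
  rw [card_eq_sum_ones]
  refine (sum_le_sum fun v hv => ?_).trans (sum_le_sum_of_subset inter_subset_right)
  simp only [mem_inter, SimpleGraph.mem_neighborFinset] at hv
  exact card_pos.2 ⟨w, mem_outNbrs.2 ⟨hv.1.symm, hw⟩⟩

/-- In a cubic graph, a proper subset containing a zero forcing set is left by at least three
edges. -/
theorem Forces.eq_univ_of_cutSize_lt {Z : Finset V} (hG : G.IsRegularOfDegree 3)
    (h : Forces G Z) : ∀ (k : ℕ) (B : Finset V), #Bᶜ = k → Z ⊆ B → cutSize G B < 3 → B = univ := by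
  intro k
  induction k using Nat.strong_induction_on with
  | _ k ih =>
  rintro B rfl hZ hcut
  by_contra hB
  have step : ∀ (C : Finset V) (x : V), B ⊆ C → x ∉ C → cutSize G (insert x C) < 3 →
      insert x C = univ := by
    intro C x hC hx hc
    refine ih _ (card_lt_card ?_) _ rfl (hZ.trans (hC.trans (subset_insert _ _))) hc
    refine compl_ssubset_compl.2 ⟨hC.trans (subset_insert _ _), fun h1 => hx (hC (h1 ?_))⟩
    exact mem_insert_self _ _
  obtain ⟨v, hv, w, hw, hvw, hout⟩ := h.exists_force hZ hB
  have hc := cutSize_insert hG hw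
  have hle := card_inter_le_cutSize (G := G) hw
  have hd : 0 < #(G.neighborFinset w ∩ B) := card_pos.2 ⟨v, by simp [hv, hvw.symm]⟩
  have hself := card_outNbrs_self hG B w
  -- With `d` neighbours of `w` in `B`, a small new cut is zero by induction, so the old cut plus
  -- three is `2d`. This contradicts `d ≤ cutSize G B < 3`.
  rcases lt_or_ge (cutSize G (insert w B)) 3 with h1 | h1
  · have h2 := step B w subset_rfl hw h1
    rw [h2, cutSize_univ] at hc
    omega
  -- Now `cutSize G B = 2` and `d = 1`, so three edges leave, two of them at `w`. Hence the next
  -- force is not made by `w`.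
  have hne0 : cutSize G (insert w B) ≠ 0 := by omega
  have hne := ne_univ_of_cutSize hne0
  obtain ⟨v', hv', w', hw', hvw', hout'⟩ :=
    h.exists_force (hZ.trans (subset_insert _ _)) hne
  have hc' := cutSize_insert hG hw'
  have hle' := card_inter_le_cutSize (G := G) hw'
  have hself' := card_outNbrs_self hG (insert w B) w'
  have hd' : 0 < #(G.neighborFinset w' ∩ insert w B) :=
    card_pos.2 ⟨v', by simp only [mem_inter, SimpleGraph.mem_neighborFinset]; exact ⟨hvw'.symm, hv'⟩⟩
  have hvw2 : v' ≠ w := by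
    rintro rfl
    rw [hout', card_singleton] at hself
    omega
  -- If the cut drops here, `w'` is the last vertex, although `w` still has two neighbours outside.
  rcases lt_or_ge (cutSize G (insert w' (insert w B))) 3 with h3 | h3
  · have h4 := step _ w' (subset_insert _ _) hw' h3
    have hall : ∀ u ∈ insert w B, outNbrs G (insert w B) u ⊆ {w'} := by
      intro u _ x hx
      have hx2 : x ∈ insert w' (insert w B) := h4 ▸ mem_univ x
      rw [mem_outNbrs] at hx
      simpa [hx.2] using hx2
    have h5 := card_le_card (hall w (mem_insert_self _ _))
    rw [card_singleton] at h5
    omega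
  · have hww : ¬ G.Adj w w' := by
      intro h5
      have h6 : ({v', w} : Finset V) ⊆ G.neighborFinset w' ∩ insert w B := by
        intro x hx
        simp only [mem_insert, mem_singleton] at hx
        simp only [mem_inter, SimpleGraph.mem_neighborFinset]
        rcases hx with rfl | rfl
        · exact ⟨hvw'.symm, hv'⟩
        · exact ⟨h5.symm, mem_insert_self _ _⟩
      have h7 := card_le_card h6
      rw [card_pair hvw2] at h7
      omega
    have hwout : #(outNbrs G (insert w' (insert w B)) w) = 2 := by
      rw [outNbrs_insert, erase_eq_of_notMem (by simp [hww])]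
      omega
    have hw'out : #(outNbrs G (insert w' (insert w B)) w') = 2 := by omega
    have hne1 : cutSize G (insert w' (insert w B)) ≠ 0 := by omega
    obtain ⟨u, hu, x, hx, hux, houtu⟩ :=
      h.exists_force (hZ.trans ((subset_insert _ _).trans (subset_insert _ _)))
        (ne_univ_of_cutSize hne1)
    have hu1 : u ≠ w := by
      rintro rfl
      rw [houtu] at hwout
      simp at hwout
    have hu2 : u ≠ w' := by
      rintro rfl
      rw [houtu] at hw'out
      simp at hw'out
    have h8 := sum_three_le (fun v => #(outNbrs G (insert w' (insert w B)) v)) hu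
      (mem_insert_of_mem (mem_insert_self w B)) (mem_insert_self w' _) hu1 hu2
      (by rintro rfl; exact hw' (mem_insert_self _ _))
    simp only [houtu, card_singleton, hwout, hw'out] at h8
    -- The four leaving edges are taken up by `w` and `w'`, two each, which leaves none for a third
    -- forcing vertex `u`.
    have : cutSize G (insert w' (insert w B)) = 4 := by omega
    unfold cutSize at this
    omega

/-- The form used in the case analyses: a cut computed to be one or two is contradictory, and a cut
of zero ends the graph. -/
theorem Forces.cutSize_eq_zero_and_eq_univ {Z B : Finset V} (hG : G.IsRegularOfDegree 3) (h : Forces G Z)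
    (hZ : Z ⊆ B) (hB : cutSize G B < 3) : cutSize G B = 0 ∧ B = univ := by
  have := h.eq_univ_of_cutSize_lt hG _ B rfl hZ hB
  exact ⟨by rw [this, cutSize_univ], this⟩

end Forcing

/-! ### Vertices, adjacency and attachment sets of the pieces, cones and compounds. -/

section Models

theorem ladder_adj {n : ℕ} {x y : Fin 2 × Fin (n + 1)} :
    (ladder n).Adj x y ↔
      (x.1 ≠ y.1 ∧ x.2 = y.2) ∨
        (x.1 = y.1 ∧ (x.2.val + 1 = y.2.val ∨ y.2.val + 1 = x.2.val)) := by
  obtain ⟨i, j⟩ := x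
  obtain ⟨k, l⟩ := y
  simp only [ladder, SimpleGraph.boxProd_adj, SimpleGraph.pathGraph_adj]
  have : (i.val + 1 = k.val ∨ k.val + 1 = i.val) ↔ i ≠ k := by
    rw [Ne, Fin.ext_iff]
    omega
  rw [this]
  tauto

/-- Ensures that no ladder vertex beyond the first rung is pendant, so none enters `attach` by
accident. -/
theorem ladder_two_neighbors {n : ℕ} (x : Fin 2 × Fin (n + 1)) (hx : x.2 ≠ 0) :
    ∃ y z, y ≠ z ∧ (ladder n).Adj x y ∧ (ladder n).Adj x z := by
  obtain ⟨i, j⟩ := x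
  have hj : j.val ≠ 0 := fun h => hx (Fin.ext h)
  refine ⟨(i + 1, j), (i, ⟨j - 1, by omega⟩), ?_, ?_, ?_⟩
  · fin_cases i <;> simp
  · rw [ladder_adj]
    fin_cases i <;> simp
  · rw [ladder_adj]
    right
    simp
    omega

namespace graphM

variable {n : ℕ}

/-- The vertices of `Mₙ` on the ladder. -/
def lad (x : Fin 2 × Fin (n + 1)) : (graphM n).V := Sum.inl x

/-- The inner vertex of the pendant path of `Mₙ`. -/
def mid (n : ℕ) : (graphM n).V := Sum.inr 0

/-- The end of the pendant path of `Mₙ`. -/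
def tip (n : ℕ) : (graphM n).V := Sum.inr 1

theorem forall_iff {P : (graphM n).V → Prop} :
    (∀ v, P v) ↔ (∀ x, P (lad x)) ∧ P (mid n) ∧ P (tip n) := by
  constructor
  · exact fun h => ⟨fun x => h _, h _, h _⟩
  · rintro ⟨h1, h2, h3⟩ (x | x)
    · exact h1 x
    · match x with
      | 0 => exact h2
      | 1 => exact h3

@[simp] theorem lad_inj {x y : Fin 2 × Fin (n + 1)} : lad x = lad y ↔ x = y := Sum.inl_injective.eq_iff
@[simp] theorem lad_ne_mid {x : Fin 2 × Fin (n + 1)} : lad x ≠ mid n := Sum.inl_ne_inr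
@[simp] theorem lad_ne_tip {x : Fin 2 × Fin (n + 1)} : lad x ≠ tip n := Sum.inl_ne_inr
@[simp] theorem mid_ne_tip : mid n ≠ tip n := fun h => absurd (Sum.inr_injective h) (by simp)

theorem adj_lad {x y : Fin 2 × Fin (n + 1)} :
    (graphM n).graph.Adj (lad x) (lad y) ↔ (ladder n).Adj x y := by
  simp [graphM, SimpleGraph.edge_adj, lad]

theorem adj_mid_tip : (graphM n).graph.Adj (mid n) (tip n) := by
  simp only [graphM, SimpleGraph.sup_adj, SimpleGraph.edge_adj, SimpleGraph.sum_adj_inr,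
    SimpleGraph.pathGraph_adj, mid, tip]
  simp

theorem adj_lad_mid {x : Fin 2 × Fin (n + 1)} :
    (graphM n).graph.Adj (lad x) (mid n) ↔ x = (0, Fin.last n) := by
  simp [graphM, SimpleGraph.edge_adj, lad, mid]

theorem not_adj_lad_tip {x : Fin 2 × Fin (n + 1)} : ¬ (graphM n).graph.Adj (lad x) (tip n) := by
  simp [graphM, SimpleGraph.edge_adj, lad, tip]

theorem white_eq : (graphM n).white = {lad (1, Fin.last n), mid n, tip n} := rfl

end graphM

namespace graphT

variable {n : ℕ}

/-- The vertices of `Tₙ` on the ladder. -/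
def lad (x : Fin 2 × Fin (n + 1)) : (graphT n).V := Sum.inl x

/-- The apex of `Tₙ`. -/
def apex (n : ℕ) : (graphT n).V := Sum.inr ()

theorem forall_iff {P : (graphT n).V → Prop} :
    (∀ v, P v) ↔ (∀ x, P (lad x)) ∧ P (apex n) := by
  constructor
  · exact fun h => ⟨fun x => h _, h _⟩
  · rintro ⟨h1, h2⟩ (x | x)
    · exact h1 x
    · exact h2

@[simp] theorem lad_inj {x y : Fin 2 × Fin (n + 1)} : lad x = lad y ↔ x = y := Sum.inl_injective.eq_iff
@[simp] theorem lad_ne_apex {x : Fin 2 × Fin (n + 1)} : lad x ≠ apex n := Sum.inl_ne_inr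

theorem adj_lad {x y : Fin 2 × Fin (n + 1)} :
    (graphT n).graph.Adj (lad x) (lad y) ↔ (ladder n).Adj x y := by
  simp [graphT, SimpleGraph.edge_adj, lad]

theorem adj_lad_apex {x : Fin 2 × Fin (n + 1)} :
    (graphT n).graph.Adj (lad x) (apex n) ↔ x.2 = Fin.last n := by
  obtain ⟨i, j⟩ := x
  simp only [graphT, SimpleGraph.sup_adj, SimpleGraph.edge_adj, lad, apex]
  fin_cases i <;> simp

end graphT

theorem Set.ncard_ne_one_of_two {α : Type*} {s : Set α} {x y : α} (hx : x ∈ s) (hy : y ∈ s)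
    (hxy : x ≠ y) : s.ncard ≠ 1 := by
  intro h
  obtain ⟨a, rfl⟩ := Set.ncard_eq_one.1 h
  exact hxy (hx.trans hy.symm)

theorem Fin.two_pair_cases {n : ℕ} {P : Fin 2 × Fin (n + 1) → Prop} (h0 : P (0, 0))
    (h1 : P (1, 0)) (h : ∀ x, x.2 ≠ 0 → P x) (x : Fin 2 × Fin (n + 1)) : P x := by
  by_cases hx : x.2 = 0
  · obtain ⟨i, j⟩ := x
    obtain rfl : j = 0 := hx
    match i with
    | 0 => exact h0
    | 1 => exact h1
  · exact h x hx

theorem graphM.mem_attach {n : ℕ} : ∀ {v : (graphM n).V}, v ∈ (graphM n).attach ↔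
    v = graphM.lad (0, 0) ∨ v = graphM.lad (1, 0) ∨ v = graphM.tip n := by
  rw [graphM.forall_iff]
  refine ⟨Fin.two_pair_cases ?_ ?_ ?_, ?_, ?_⟩
  · exact iff_of_true (Or.inl (Or.inl rfl)) (Or.inl rfl)
  · exact iff_of_true (Or.inl (Or.inr rfl)) (Or.inr (Or.inl rfl))
  · intro x hx
    refine iff_of_false ?_ ?_
    · rintro ((h | h) | h)
      · rw [Sum.inl_injective h] at hx; exact hx rfl
      · rw [Sum.inl_injective h] at hx; exact hx rfl
      · obtain ⟨y, z, hyz, hy, hz⟩ := ladder_two_neighbors x hx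
        exact absurd h (Set.ncard_ne_one_of_two (x := graphM.lad y) (y := graphM.lad z)
          (graphM.adj_lad.2 hy) (graphM.adj_lad.2 hz) (by simpa using hyz))
    · rintro (h | h | h)
      · rw [graphM.lad_inj.1 h] at hx; exact hx rfl
      · rw [graphM.lad_inj.1 h] at hx; exact hx rfl
      · exact graphM.lad_ne_tip h
  · refine iff_of_false ?_ ?_
    · rintro ((h | h) | h)
      · exact Sum.inr_ne_inl h
      · exact Sum.inr_ne_inl h
      · exact absurd h (Set.ncard_ne_one_of_two (x := graphM.lad (0, Fin.last n))
            (y := graphM.tip n) (graphM.adj_lad_mid.2 rfl).symm graphM.adj_mid_tip (by simp))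
    · rintro (h | h | h)
      · exact graphM.lad_ne_mid h.symm
      · exact graphM.lad_ne_mid h.symm
      · exact graphM.mid_ne_tip h
  · refine iff_of_true (Or.inr ?_) (Or.inr (Or.inr rfl))
    rw [Set.ncard_eq_one]
    refine ⟨graphM.mid n, Set.ext ?_⟩
    rw [graphM.forall_iff]
    refine ⟨fun x => iff_of_false (fun h => graphM.not_adj_lad_tip (SimpleGraph.Adj.symm h)) ?_,
      iff_of_true (SimpleGraph.Adj.symm graphM.adj_mid_tip) rfl,
      iff_of_false (fun h => (graphM n).graph.irrefl h) ?_⟩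
    · exact graphM.lad_ne_mid
    · exact graphM.mid_ne_tip.symm

theorem graphT.mem_attach {n : ℕ} : ∀ {v : (graphT n).V}, v ∈ (graphT n).attach ↔
    v = graphT.lad (0, 0) ∨ v = graphT.lad (1, 0) ∨ v = graphT.apex n := by
  rw [graphT.forall_iff]
  refine ⟨Fin.two_pair_cases ?_ ?_ ?_, ?_⟩
  · exact iff_of_true (Or.inl (Or.inl rfl)) (Or.inl rfl)
  · exact iff_of_true (Or.inl (Or.inr (Or.inl rfl))) (Or.inr (Or.inl rfl))
  · intro x hx
    refine iff_of_false ?_ ?_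
    · rintro ((h | h | h) | h)
      · rw [Sum.inl_injective h] at hx; exact hx rfl
      · rw [Sum.inl_injective h] at hx; exact hx rfl
      · exact Sum.inl_ne_inr h
      · obtain ⟨y, z, hyz, hy, hz⟩ := ladder_two_neighbors x hx
        exact absurd h (Set.ncard_ne_one_of_two (x := graphT.lad y) (y := graphT.lad z)
          (graphT.adj_lad.2 hy) (graphT.adj_lad.2 hz) (by simpa using hyz))
    · rintro (h | h | h)
      · rw [graphT.lad_inj.1 h] at hx; exact hx rfl
      · rw [graphT.lad_inj.1 h] at hx; exact hx rfl
      · exact graphT.lad_ne_apex h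
  · exact iff_of_true (Or.inl (Or.inr (Or.inr rfl))) (Or.inr (Or.inr rfl))

namespace ColoredGraph

/-- The new vertex of the cone. -/
def coneApex (G : ColoredGraph) : G.cone.V := Sum.inl ()

/-- The inclusion of a graph into its cone. -/
def toCone {G : ColoredGraph} (x : G.V) : G.cone.V := Sum.inr x

theorem cone_forall_iff {G : ColoredGraph} {P : G.cone.V → Prop} :
    (∀ v, P v) ↔ P G.coneApex ∧ ∀ x, P (toCone x) := by
  constructor
  · exact fun h => ⟨h _, fun x => h _⟩
  · rintro ⟨h1, h2⟩ (x | x)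
    · exact h1
    · exact h2 x

theorem cone_adj_apex {G : ColoredGraph} {y : G.V} :
    G.cone.graph.Adj G.coneApex (toCone y) ↔ y ∈ G.attach := by
  simp [cone, coneApex, toCone]

theorem cone_adj {G : ColoredGraph} {x y : G.V} :
    G.cone.graph.Adj (toCone x) (toCone y) ↔ G.graph.Adj x y := by
  simp [cone, toCone]

theorem toCone_injective {G : ColoredGraph} : Function.Injective (toCone (G := G)) :=
  Sum.inr_injective

theorem toCone_mem_white {G : ColoredGraph} {x : G.V} : toCone x ∈ G.cone.white ↔ x ∈ G.white :=
  Sum.inr_injective.mem_set_image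

theorem coneApex_notMem_white {G : ColoredGraph} : G.coneApex ∉ G.cone.white := by
  rintro ⟨x, -, hx⟩
  exact Sum.inr_ne_inl hx

variable {G H : ColoredGraph} (f : G.white ≃ H.attach)

/-- The inclusion of the left factor into a compound. -/
def inLeft (x : G.V) : (G.compound H f).V := Sum.inl x

/-- The inclusion of the right factor into a compound. -/
def inRight (x : H.V) : (G.compound H f).V := Sum.inr x

variable {f}

theorem compound_forall_iff {P : (G.compound H f).V → Prop} :
    (∀ v, P v) ↔ (∀ x, P (inLeft f x)) ∧ ∀ x, P (inRight f x) := by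
  constructor
  · exact fun h => ⟨fun x => h _, fun x => h _⟩
  · rintro ⟨h1, h2⟩ (x | x)
    · exact h1 x
    · exact h2 x

theorem inLeft_injective : Function.Injective (inLeft f) := Sum.inl_injective

theorem inRight_injective : Function.Injective (inRight f) := Sum.inr_injective

theorem compound_adj_left {x y : G.V} :
    (G.compound H f).graph.Adj (inLeft f x) (inLeft f y) ↔ G.graph.Adj x y := by
  simp [compound, inLeft]

theorem compound_adj_right {x y : H.V} :
    (G.compound H f).graph.Adj (inRight f x) (inRight f y) ↔ H.graph.Adj x y := by
  simp [compound, inRight]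

theorem compound_adj_left_right {x : G.V} {y : H.V} :
    (G.compound H f).graph.Adj (inLeft f x) (inRight f y) ↔
      ∃ h : x ∈ G.white, y = f ⟨x, h⟩ := by
  simp only [compound, SimpleGraph.sup_adj, SimpleGraph.fromRel_adj, inLeft, inRight]
  simp [eq_comm]

theorem inRight_mem_white {x : H.V} : inRight f x ∈ (G.compound H f).white ↔ x ∈ H.white :=
  Sum.inr_injective.mem_set_image

theorem inLeft_notMem_white {x : G.V} : inLeft f x ∉ (G.compound H f).white := by
  rintro ⟨y, -, hy⟩
  exact Sum.inr_ne_inl hy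

end ColoredGraph

end Models

/-! ### Recognising induced ladders and induced copies of `Mₙ` and `Tₙ`. -/

section LadderMaps

variable {V : Type*}

/-- The vertices `a 0, …, a n` and `b 0, …, b n` are distinct and induce a ladder. -/
structure IsLadder (G : SimpleGraph V) (n : ℕ) (a b : ℕ → V) : Prop where
  inj_left : ∀ i ≤ n, ∀ j ≤ n, a i = a j → i = j
  inj_right : ∀ i ≤ n, ∀ j ≤ n, b i = b j → i = j
  ne : ∀ i ≤ n, ∀ j ≤ n, a i ≠ b j
  adj_left : ∀ i ≤ n, ∀ j ≤ n, (G.Adj (a i) (a j) ↔ i + 1 = j ∨ j + 1 = i)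
  adj_right : ∀ i ≤ n, ∀ j ≤ n, (G.Adj (b i) (b j) ↔ i + 1 = j ∨ j + 1 = i)
  adj : ∀ i ≤ n, ∀ j ≤ n, (G.Adj (a i) (b j) ↔ i = j)

variable {G : SimpleGraph V} {n : ℕ} {a b : ℕ → V}

theorem IsLadder.symm (h : IsLadder G n a b) : IsLadder G n b a where
  inj_left := h.inj_right
  inj_right := h.inj_left
  ne i hi j hj := (h.ne j hj i hi).symm
  adj_left := h.adj_right
  adj_right := h.adj_left
  adj i hi j hj := by rw [G.adj_comm, h.adj j hj i hi, eq_comm]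

/-- The rows are total functions with arbitrary values beyond `n`, so a rung is added by overwriting
the value at `n + 1`, with no change of type. -/
theorem IsLadder.extend (h : IsLadder G n a b) {a' b' : V} (hab : G.Adj a' b')
    (ha : ∀ i ≤ n, a i ≠ a' ∧ a i ≠ b' ∧ (G.Adj (a i) a' ↔ i = n) ∧ ¬ G.Adj (a i) b')
    (hb : ∀ i ≤ n, b i ≠ a' ∧ b i ≠ b' ∧ (G.Adj (b i) b' ↔ i = n) ∧ ¬ G.Adj (b i) a') :
    IsLadder G (n + 1) (Function.update a (n + 1) a') (Function.update b (n + 1) b') := by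
  -- Splits each condition on a pair of indices into old-old, old-new, new-old and new-new.
  have key : ∀ P : ℕ → ℕ → Prop, (∀ i ≤ n, ∀ j ≤ n, P i j) → (∀ i ≤ n, P i (n + 1)) →
      (∀ i ≤ n, P (n + 1) i) → P (n + 1) (n + 1) → ∀ i ≤ n + 1, ∀ j ≤ n + 1, P i j := by
    intro P h1 h2 h3 h4 i hi j hj
    rcases Nat.le_succ_iff.1 hi with hi | rfl <;> rcases Nat.le_succ_iff.1 hj with hj | rfl
    · exact h1 i hi j hj
    · exact h2 i hi
    · exact h3 j hj
    · exact h4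
  have up : ∀ (f : ℕ → V) (x : V) (i : ℕ), i ≤ n → Function.update f (n + 1) x i = f i :=
    fun f x i hi => Function.update_of_ne (by omega) _ _
  constructor <;> apply key
  · intro i hi j hj
    rw [up _ _ _ hi, up _ _ _ hj]
    exact h.inj_left i hi j hj
  · intro i hi
    rw [up _ _ _ hi, Function.update_self]
    exact fun h1 => absurd h1 (ha i hi).1
  · intro i hi
    rw [up _ _ _ hi, Function.update_self]
    exact fun h1 => absurd h1.symm (ha i hi).1
  · simp
  · intro i hi j hj
    rw [up _ _ _ hi, up _ _ _ hj]
    exact h.inj_right i hi j hj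
  · intro i hi
    rw [up _ _ _ hi, Function.update_self]
    exact fun h1 => absurd h1 (hb i hi).2.1
  · intro i hi
    rw [up _ _ _ hi, Function.update_self]
    exact fun h1 => absurd h1.symm (hb i hi).2.1
  · simp
  · intro i hi j hj
    rw [up _ _ _ hi, up _ _ _ hj]
    exact h.ne i hi j hj
  · intro i hi
    rw [up _ _ _ hi, Function.update_self]
    exact (ha i hi).2.1
  · intro i hi
    rw [up _ _ _ hi, Function.update_self]
    exact (hb i hi).1.symm
  · simpa using hab.ne
  · intro i hi j hj
    rw [up _ _ _ hi, up _ _ _ hj]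
    exact h.adj_left i hi j hj
  · intro i hi
    rw [up _ _ _ hi, Function.update_self, (ha i hi).2.2.1]
    omega
  · intro i hi
    rw [up _ _ _ hi, Function.update_self, G.adj_comm, (ha i hi).2.2.1]
    omega
  · simp
  · intro i hi j hj
    rw [up _ _ _ hi, up _ _ _ hj]
    exact h.adj_right i hi j hj
  · intro i hi
    rw [up _ _ _ hi, Function.update_self, (hb i hi).2.2.1]
    omega
  · intro i hi
    rw [up _ _ _ hi, Function.update_self, G.adj_comm, (hb i hi).2.2.1]
    omega
  · simp
  · intro i hi j hj
    rw [up _ _ _ hi, up _ _ _ hj]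
    exact h.adj i hi j hj
  · intro i hi
    rw [up _ _ _ hi, Function.update_self]
    exact iff_of_false (ha i hi).2.2.2 (by omega)
  · intro i hi
    rw [up _ _ _ hi, Function.update_self, G.adj_comm]
    exact iff_of_false (hb i hi).2.2.2 (by omega)
  · simpa using hab

/-- The map from the vertices of a ladder given by its two rows. -/
def ladderMap (n : ℕ) (a b : ℕ → V) (x : Fin 2 × Fin (n + 1)) : V :=
  if x.1 = 0 then a x.2 else b x.2

theorem IsLadder.ladderMap_injective (h : IsLadder G n a b) :
    Function.Injective (ladderMap n a b) := by
  rintro ⟨i, j⟩ ⟨k, l⟩ hx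
  have hj : j.val ≤ n := by omega
  have hl : l.val ≤ n := by omega
  have h1 := h.inj_left j hj l hl
  have h2 := h.inj_right j hj l hl
  have h3 := h.ne j hj l hl
  have h4 := h.ne l hl j hj
  fin_cases i <;> fin_cases k <;> simp [ladderMap] at hx
  · simp [Fin.ext (h1 hx)]
  · exact absurd hx h3
  · exact absurd hx.symm h4
  · simp [Fin.ext (h2 hx)]

theorem IsLadder.ladderMap_adj (h : IsLadder G n a b) (x y : Fin 2 × Fin (n + 1)) :
    G.Adj (ladderMap n a b x) (ladderMap n a b y) ↔ (ladder n).Adj x y := by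
  obtain ⟨i, j⟩ := x
  obtain ⟨k, l⟩ := y
  have hj : j.val ≤ n := by omega
  have hl : l.val ≤ n := by omega
  have h1 := h.adj_left j hj l hl
  have h2 := h.adj_right j hj l hl
  have h3 := h.adj j hj l hl
  have h4 := h.symm.adj j hj l hl
  rw [ladder_adj]
  fin_cases i <;> fin_cases k <;> simp [ladderMap, *, Fin.ext_iff]

theorem ladderMap_forall {P : V → Prop} :
    (∀ x, P (ladderMap n a b x)) ↔ ∀ i ≤ n, P (a i) ∧ P (b i) := by
  constructor
  · intro h i hi
    exact ⟨by simpa [ladderMap] using h (0, ⟨i, by omega⟩),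
      by simpa [ladderMap] using h (1, ⟨i, by omega⟩)⟩
  · rintro h ⟨i, j⟩
    have := h j (by omega)
    fin_cases i <;> simp [ladderMap, this]

/-- The map from the vertices of `Mₙ` given by the rows of the ladder and the pendant path. -/
def mapM (n : ℕ) (a b : ℕ → V) (p q : V) (v : (graphM n).V) : V :=
  Sum.elim (ladderMap n a b) (fun k : Fin 2 => if k = 0 then p else q) v

@[simp] theorem mapM_lad {p q : V} (x : Fin 2 × Fin (n + 1)) :
    mapM n a b p q (graphM.lad x) = ladderMap n a b x := rfl
@[simp] theorem mapM_mid {p q : V} : mapM n a b p q (graphM.mid n) = p := rfl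
@[simp] theorem mapM_tip {p q : V} : mapM n a b p q (graphM.tip n) = q := rfl

/-- The map from the vertices of `Tₙ` given by the rows of the ladder and the apex. -/
def mapT (n : ℕ) (a b : ℕ → V) (c : V) (v : (graphT n).V) : V :=
  Sum.elim (ladderMap n a b) (fun _ : Unit => c) v

@[simp] theorem mapT_lad {c : V} (x : Fin 2 × Fin (n + 1)) :
    mapT n a b c (graphT.lad x) = ladderMap n a b x := rfl
@[simp] theorem mapT_apex {c : V} : mapT n a b c (graphT.apex n) = c := rfl

theorem ladderMap_adj_iff {p : V} (ha : ∀ i ≤ n, G.Adj (a i) p ↔ i = n)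
    (hb : ∀ i ≤ n, ¬ G.Adj (b i) p) (x : Fin 2 × Fin (n + 1)) :
    G.Adj (ladderMap n a b x) p ↔ x = (0, Fin.last n) := by
  obtain ⟨i, j⟩ := x
  have h1 := ha j (by omega)
  have h2 := hb j (by omega)
  fin_cases i <;> simp [ladderMap, h1, h2, Fin.ext_iff]

theorem ladderMap_adj_iff_last {p : V} (ha : ∀ i ≤ n, G.Adj (a i) p ↔ i = n)
    (hb : ∀ i ≤ n, G.Adj (b i) p ↔ i = n) (x : Fin 2 × Fin (n + 1)) :
    G.Adj (ladderMap n a b x) p ↔ x.2 = Fin.last n := by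
  obtain ⟨i, j⟩ := x
  have h1 := ha j (by omega)
  have h2 := hb j (by omega)
  fin_cases i <;> simp [ladderMap, h1, h2, Fin.ext_iff]

/-- An induced copy of `Mₙ`, assembled from a ladder and the two vertices of the pendant path. -/
def IsLadder.embeddingM (h : IsLadder G n a b) {p q : V} (hpq : G.Adj p q)
    (ha : ∀ i ≤ n, a i ≠ p ∧ a i ≠ q ∧ (G.Adj (a i) p ↔ i = n) ∧ ¬ G.Adj (a i) q)
    (hb : ∀ i ≤ n, b i ≠ p ∧ b i ≠ q ∧ ¬ G.Adj (b i) p ∧ ¬ G.Adj (b i) q) :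
    (graphM n).graph ↪g G where
  toFun := mapM n a b p q
  inj' := by
    have h1 := (ladderMap_forall (n := n) (a := a) (b := b) (P := fun v => v ≠ p ∧ v ≠ q)).2
      fun i hi => ⟨⟨(ha i hi).1, (ha i hi).2.1⟩, (hb i hi).1, (hb i hi).2.1⟩
    unfold Function.Injective
    simp only [graphM.forall_iff, mapM_lad, mapM_mid, mapM_tip]
    refine ⟨fun x => ⟨fun y hxy => ?_, fun h2 => ?_, fun h2 => ?_⟩,
      ⟨fun x h2 => ?_, fun _ => trivial, fun h2 => ?_⟩, fun x h2 => ?_, fun h2 => ?_, fun _ => trivial⟩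
    · rw [h.ladderMap_injective hxy]
    · exact absurd h2 (h1 x).1
    · exact absurd h2 (h1 x).2
    · exact absurd h2.symm (h1 x).1
    · exact absurd h2 hpq.ne
    · exact absurd h2.symm (h1 x).2
    · exact absurd h2 hpq.ne'
  map_rel_iff' := by
    have h1 := ladderMap_adj_iff (G := G) (fun i hi => (ha i hi).2.2.1) fun i hi => (hb i hi).2.2.1
    have h2 := (ladderMap_forall (n := n) (a := a) (b := b) (P := fun v => ¬ G.Adj v q)).2
      fun i hi => ⟨(ha i hi).2.2.2, (hb i hi).2.2.2⟩
    change ∀ {x y}, G.Adj (mapM n a b p q x) (mapM n a b p q y) ↔ (graphM n).graph.Adj x y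
    simp only [graphM.forall_iff, mapM_lad, mapM_mid, mapM_tip]
    refine ⟨fun x => ⟨fun y => ?_, ?_, ?_⟩, ⟨fun x => ?_, ?_, ?_⟩, fun x => ?_, ?_, ?_⟩
    · exact (h.ladderMap_adj x y).trans graphM.adj_lad.symm
    · exact (h1 x).trans graphM.adj_lad_mid.symm
    · exact iff_of_false (h2 x) graphM.not_adj_lad_tip
    · exact (G.adj_comm _ _).trans <|
        (h1 x).trans (graphM.adj_lad_mid.symm.trans (SimpleGraph.adj_comm _ _ _))
    · simp
    · exact iff_of_true hpq graphM.adj_mid_tip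
    · exact iff_of_false (fun h3 => h2 x h3.symm) fun h3 => graphM.not_adj_lad_tip h3.symm
    · exact iff_of_true hpq.symm graphM.adj_mid_tip.symm
    · simp

/-- An induced copy of `Tₙ`, assembled from a ladder and the apex. -/
def IsLadder.embeddingT (h : IsLadder G n a b) {c : V}
    (ha : ∀ i ≤ n, a i ≠ c ∧ (G.Adj (a i) c ↔ i = n))
    (hb : ∀ i ≤ n, b i ≠ c ∧ (G.Adj (b i) c ↔ i = n)) :
    (graphT n).graph ↪g G where
  toFun := mapT n a b c
  inj' := by
    have h1 := (ladderMap_forall (n := n) (a := a) (b := b) (P := fun v => v ≠ c)).2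
      fun i hi => ⟨(ha i hi).1, (hb i hi).1⟩
    unfold Function.Injective
    simp only [graphT.forall_iff, mapT_lad, mapT_apex]
    refine ⟨fun x => ⟨fun y hxy => ?_, fun h2 => ?_⟩, fun x h2 => ?_, fun _ => trivial⟩
    · rw [h.ladderMap_injective hxy]
    · exact absurd h2 (h1 x)
    · exact absurd h2.symm (h1 x)
  map_rel_iff' := by
    have h1 := ladderMap_adj_iff_last (G := G) (fun i hi => (ha i hi).2) fun i hi => (hb i hi).2
    change ∀ {x y}, G.Adj (mapT n a b c x) (mapT n a b c y) ↔ (graphT n).graph.Adj x y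
    simp only [graphT.forall_iff, mapT_lad, mapT_apex]
    refine ⟨fun x => ⟨fun y => ?_, ?_⟩, fun x => ?_, ?_⟩
    · exact (h.ladderMap_adj x y).trans graphT.adj_lad.symm
    · exact (h1 x).trans graphT.adj_lad_apex.symm
    · exact (G.adj_comm _ _).trans <|
        (h1 x).trans (graphT.adj_lad_apex.symm.trans (SimpleGraph.adj_comm _ _ _))
    · simp

end LadderMaps

/-! ### Black sets whose leaving edges start at three vertices. -/

section Tips

variable {V : Type*} {G : SimpleGraph V} [Fintype V] [DecidableEq V] [DecidableRel G.Adj]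

/-- All edges leaving `B` start at one of the three vertices `a`, `b`, `c` of `B`. -/
structure Tips (G : SimpleGraph V) [DecidableRel G.Adj] (B : Finset V) (a b c : V) : Prop where
  mem_left : a ∈ B
  mem_mid : b ∈ B
  mem_right : c ∈ B
  ne₁₂ : a ≠ b
  ne₁₃ : a ≠ c
  ne₂₃ : b ≠ c
  outNbrs_eq : ∀ v ∈ B, v ≠ a → v ≠ b → v ≠ c → outNbrs G B v = ∅

variable {B Z : Finset V} {a b c : V}

theorem Tips.swap (h : Tips G B a b c) : Tips G B b a c :=
  ⟨h.mem_mid, h.mem_left, h.mem_right, h.ne₁₂.symm, h.ne₂₃, h.ne₁₃,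
    fun v hv h1 h2 h3 => h.outNbrs_eq v hv h2 h1 h3⟩

theorem Tips.rotate (h : Tips G B a b c) : Tips G B b c a :=
  ⟨h.mem_mid, h.mem_right, h.mem_left, h.ne₂₃, h.ne₁₂.symm, h.ne₁₃.symm,
    fun v hv h1 h2 h3 => h.outNbrs_eq v hv h3 h1 h2⟩

theorem Tips.eq_of_adj (h : Tips G B a b c) {v w : V} (hv : v ∈ B) (hw : w ∉ B)
    (hvw : G.Adj v w) : v = a ∨ v = b ∨ v = c := by
  by_contra! hcon
  have := h.outNbrs_eq v hv hcon.1 hcon.2.1 hcon.2.2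
  exact notMem_empty w (this ▸ mem_outNbrs.2 ⟨hvw, hw⟩)

theorem Tips.cutSize_eq (h : Tips G B a b c) :
    cutSize G B = #(outNbrs G B a) + #(outNbrs G B b) + #(outNbrs G B c) := by
  have h1 : ({a, b, c} : Finset V) ⊆ B := by
    simp [insert_subset_iff, h.mem_left, h.mem_mid, h.mem_right]
  unfold cutSize
  rw [← sum_subset h1]
  · rw [sum_insert (by simp [h.ne₁₂, h.ne₁₃]), sum_insert (by simp [h.ne₂₃]), sum_singleton]
    omega
  · intro v hv hv'
    simp only [mem_insert, mem_singleton, not_or] at hv'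
    rw [h.outNbrs_eq v hv hv'.1 hv'.2.1 hv'.2.2, card_empty]

theorem Tips.card_inter (h : Tips G B a b c) {w : V} (hw : w ∉ B) :
    #(G.neighborFinset w ∩ B) = (if G.Adj a w then 1 else 0) + (if G.Adj b w then 1 else 0) +
      (if G.Adj c w then 1 else 0) := by
  have h1 : G.neighborFinset w ∩ B = ({a, b, c} : Finset V).filter fun v => G.Adj v w := by
    ext v
    simp only [mem_inter, SimpleGraph.mem_neighborFinset, mem_filter, mem_insert, mem_singleton]
    constructor
    · rintro ⟨h1, h2⟩
      exact ⟨h.eq_of_adj h2 hw h1.symm, h1.symm⟩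
    · rintro ⟨rfl | rfl | rfl, h2⟩
      · exact ⟨h2.symm, h.mem_left⟩
      · exact ⟨h2.symm, h.mem_mid⟩
      · exact ⟨h2.symm, h.mem_right⟩
  rw [h1, card_filter, sum_insert (by simp [h.ne₁₂, h.ne₁₃]), sum_insert (by simp [h.ne₂₃]),
    sum_singleton]
  omega

/-- Only a tip can force, so tips none of which has exactly one outer neighbour are stuck. The
numerical conclusion is meant to clash with a positive count of leaving edges. -/
theorem Tips.eq_univ (h : Tips G B a b c) (hF : Forces G Z) (hZ : Z ⊆ B)
    (h1 : #(outNbrs G B a) ≠ 1) (h2 : #(outNbrs G B b) ≠ 1) (h3 : #(outNbrs G B c) ≠ 1) :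
    cutSize G B = 0 := by
  have : B = univ := by
    refine hF B hZ fun v hv => ?_
    by_cases ha : v = a
    · rwa [ha]
    by_cases hb : v = b
    · rwa [hb]
    by_cases hc : v = c
    · rwa [hc]
    rw [h.outNbrs_eq v hv ha hb hc]
    simp
  rw [this, cutSize_univ]

theorem adj_iff_of_outNbrs {v w x : V} (h : outNbrs G B v = {x}) (hw : w ∉ B) :
    G.Adj v w ↔ w = x := by
  have : w ∈ outNbrs G B v ↔ w ∈ ({x} : Finset V) := by rw [h]
  simpa [hw] using this

theorem outNbrs_singleton {v x : V} (h : outNbrs G B v = {x}) : G.Adj v x ∧ x ∉ B :=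
  mem_outNbrs.1 (h ▸ mem_singleton_self x)

theorem card_outNbrs_insert {v w : V} (hw : w ∉ B) :
    #(outNbrs G (insert w B) v) + (if G.Adj v w then 1 else 0) = #(outNbrs G B v) := by
  rw [outNbrs_insert]
  split_ifs with h
  · exact card_erase_add_one (mem_outNbrs.2 ⟨h, hw⟩)
  · rw [erase_eq_of_notMem (by simp [h]), add_zero]

theorem Tips.advance (h : Tips G B a b c) {x : V} (hx : outNbrs G B a = {x}) :
    Tips G (insert x B) x b c := by
  have hxB := (outNbrs_singleton hx).2
  refine ⟨mem_insert_self _ _, mem_insert_of_mem h.mem_mid, mem_insert_of_mem h.mem_right,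
    fun h1 => hxB (h1 ▸ h.mem_mid), fun h1 => hxB (h1 ▸ h.mem_right), h.ne₂₃, ?_⟩
  intro v hv h1 h2 h3
  have hv' : v ∈ B := mem_of_mem_insert_of_ne hv h1
  rw [outNbrs_insert]
  by_cases h4 : v = a
  · rw [h4, hx, erase_singleton]
  · rw [h.outNbrs_eq v hv' h4 h2 h3, erase_empty]

/-- One of the three edges at `x` goes to `a`. The other two go to `b`, to `c` or outside. -/
theorem Tips.card_outNbrs_advance (h : Tips G B a b c) (hG : G.IsRegularOfDegree 3) {x : V}
    (hx : outNbrs G B a = {x}) :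
    #(outNbrs G (insert x B) x) + (if G.Adj b x then 1 else 0) + (if G.Adj c x then 1 else 0)
      = 2 := by
  have h1 := card_outNbrs_self hG B x
  rw [h.card_inter (outNbrs_singleton hx).2, if_pos (outNbrs_singleton hx).1] at h1
  omega

/-- If just two of the three leaving edges met at `x`, adding `x` would change the cut from three to
two. -/
theorem Tips.eq_of_eq (h : Tips G B a b c) (hG : G.IsRegularOfDegree 3) (hF : Forces G Z)
    (hZ : Z ⊆ B) {x y : V} (ha : outNbrs G B a = {x}) (hb : outNbrs G B b = {x})
    (hc : outNbrs G B c = {y}) : x = y := by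
  by_contra hxy
  have hx := outNbrs_singleton ha
  have h1 := h.card_inter hx.2
  rw [if_pos hx.1, if_pos (outNbrs_singleton hb).1,
    if_neg (fun h2 => hxy ((adj_iff_of_outNbrs hc hx.2).1 h2))] at h1
  have h2 := cutSize_insert hG hx.2
  have h3 := h.cutSize_eq
  rw [ha, hb, hc] at h3
  simp only [card_singleton] at h3
  have h4 := hF.cutSize_eq_zero_and_eq_univ hG (hZ.trans (subset_insert x B)) (by omega)
  omega

theorem Tips.eq_or_distinct (h : Tips G B a b c) (hG : G.IsRegularOfDegree 3) (hF : Forces G Z)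
    (hZ : Z ⊆ B) {x y z : V} (ha : outNbrs G B a = {x}) (hb : outNbrs G B b = {y})
    (hc : outNbrs G B c = {z}) : (x = y ∧ x = z ∧ insert x B = univ) ∨ (x ≠ y ∧ x ≠ z ∧ y ≠ z) := by
  by_cases hall : x = y ∧ x = z
  · obtain ⟨rfl, rfl⟩ := hall
    refine Or.inl ⟨rfl, rfl, ?_⟩
    have hx := outNbrs_singleton ha
    have h1 := h.card_inter hx.2
    rw [if_pos hx.1, if_pos (outNbrs_singleton hb).1, if_pos (outNbrs_singleton hc).1] at h1
    have h2 := cutSize_insert hG hx.2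
    have h3 := h.cutSize_eq
    rw [ha, hb, hc] at h3
    simp only [card_singleton] at h3
    exact (hF.cutSize_eq_zero_and_eq_univ hG (hZ.trans (subset_insert x B)) (by omega)).2
  · refine Or.inr ⟨?_, ?_, ?_⟩
    · rintro rfl
      exact hall ⟨rfl, h.eq_of_eq hG hF hZ ha hb hc⟩
    · rintro rfl
      exact hall ⟨h.rotate.rotate.eq_of_eq hG hF hZ hc ha hb, rfl⟩
    · rintro rfl
      have := h.rotate.eq_of_eq hG hF hZ hb hc ha
      exact hall ⟨this.symm, this.symm⟩

end Tips

/-! ### Growing one piece `Mₙ` or `Tₘ` beyond a region. -/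

section Phase

variable {V : Type*} {G : SimpleGraph V}

/-- Beyond the region `R`, whose neighbours outside are the vertices of `S`, the graph `G`
continues with an induced `Mₙ`, or `Tₘ` is all that is left. -/
def Continues (G : SimpleGraph V) (R : Finset V) (S : Set V) : Prop :=
  (∃ m, ∃ ψ : (graphT m).graph ↪g G, (∀ v, v ∈ Set.range ψ ↔ v ∉ R) ∧
    ψ '' (graphT m).attach = S) ∨
  (∃ n, ∃ ψ : (graphM n).graph ↪g G, (∀ t, ψ t ∉ R) ∧ ψ '' (graphM n).attach = S ∧
    ∃ g : (graphM n).V → V, Set.InjOn g (graphM n).white ∧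
      (∀ t ∈ (graphM n).white, g t ∉ R ∧ g t ∉ Set.range ψ) ∧
      (∀ v ∉ R, v ∉ Set.range ψ → ∀ u ∈ R, ¬ G.Adj u v) ∧
      ∀ t, ∀ v ∉ R, v ∉ Set.range ψ → (G.Adj (ψ t) v ↔ t ∈ (graphM n).white ∧ v = g t))

theorem exists_ladderMap_eq {n : ℕ} {a b : ℕ → V} {v : V} :
    (∃ x, ladderMap n a b x = v) ↔ ∃ i ≤ n, v = a i ∨ v = b i := by
  have := ladderMap_forall (n := n) (a := a) (b := b) (P := fun w => w ≠ v)
  rw [← not_iff_not]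
  push Not
  refine this.trans (forall₂_congr fun i _ => ?_)
  exact and_congr ne_comm ne_comm

theorem mem_range_mapM {n : ℕ} {a b : ℕ → V} {p q v : V} :
    v ∈ Set.range (mapM n a b p q) ↔ (∃ i ≤ n, v = a i ∨ v = b i) ∨ v = p ∨ v = q := by
  rw [← exists_ladderMap_eq, ← not_iff_not]
  simp only [Set.mem_range, not_exists, not_or, graphM.forall_iff, mapM_lad, mapM_mid, mapM_tip]
  rw [eq_comm (a := v) (b := p), eq_comm (a := v) (b := q)]

theorem mem_range_mapT {n : ℕ} {a b : ℕ → V} {c v : V} :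
    v ∈ Set.range (mapT n a b c) ↔ (∃ i ≤ n, v = a i ∨ v = b i) ∨ v = c := by
  rw [← exists_ladderMap_eq, ← not_iff_not]
  simp only [Set.mem_range, not_exists, not_or, graphT.forall_iff, mapT_lad, mapT_apex]
  rw [eq_comm (a := v) (b := c)]

theorem image_mapM_attach {n : ℕ} {a b : ℕ → V} {p q : V} :
    mapM n a b p q '' (graphM n).attach = {a 0, b 0, q} := by
  have : (graphM n).attach = {graphM.lad (0, 0), graphM.lad (1, 0), graphM.tip n} :=
    Set.ext fun v => graphM.mem_attach
  rw [this, Set.image_insert_eq, Set.image_insert_eq, Set.image_singleton]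
  simp [ladderMap]

theorem image_mapT_attach {n : ℕ} {a b : ℕ → V} {c : V} :
    mapT n a b c '' (graphT n).attach = {a 0, b 0, c} := by
  have : (graphT n).attach = {graphT.lad (0, 0), graphT.lad (1, 0), graphT.apex n} :=
    Set.ext fun v => graphT.mem_attach
  rw [this, Set.image_insert_eq, Set.image_insert_eq, Set.image_singleton]
  simp [ladderMap]

theorem forall_update {n : ℕ} {a : ℕ → V} {x : V} {P : ℕ → V → Prop} (h : ∀ i ≤ n, P i (a i))
    (hx : P (n + 1) x) : ∀ i ≤ n + 1, P i (Function.update a (n + 1) x i) := by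
  intro i hi
  rcases Nat.le_succ_iff.1 hi with hi | rfl
  · rw [Function.update_of_ne (by omega)]
    exact h i hi
  · rwa [Function.update_self]

theorem exists_update {n : ℕ} {a b : ℕ → V} {x y v : V} :
    (∃ i ≤ n + 1, v = Function.update a (n + 1) x i ∨ v = Function.update b (n + 1) y i) ↔
      (∃ i ≤ n, v = a i ∨ v = b i) ∨ v = x ∨ v = y := by
  constructor
  · rintro ⟨i, hi, h⟩
    rcases Nat.le_succ_iff.1 hi with hi | rfl
    · rw [Function.update_of_ne (by omega), Function.update_of_ne (by omega)] at h
      exact Or.inl ⟨i, hi, h⟩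
    · simpa using Or.inr h
  · rintro (⟨i, hi, h⟩ | h)
    · refine ⟨i, by omega, ?_⟩
      rwa [Function.update_of_ne (by omega), Function.update_of_ne (by omega)]
    · exact ⟨n + 1, le_rfl, by simpa using h⟩

theorem insert_rotate {V : Type*} [DecidableEq V] {R : Finset V} {x y z : V} :
    insert y (insert z (insert x R)) = insert x (insert y (insert z R)) := by
  ext v
  simp only [mem_insert]
  tauto

variable [Fintype V] [DecidableEq V] [DecidableRel G.Adj]

/-- The set `B` consists of `R`, an induced ladder with both ends `a n`, `b n` of its last rung
having one neighbour outside `B`, and a vertex `c` with two neighbours outside `B`. -/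
structure LadderState (G : SimpleGraph V) [DecidableRel G.Adj] (R : Finset V) (n : ℕ)
    (a b : ℕ → V) (c : V) (B : Finset V) : Prop where
  isLadder : IsLadder G n a b
  mem_iff : ∀ v, v ∈ B ↔ v ∈ R ∨ (∃ i ≤ n, v = a i ∨ v = b i) ∨ v = c
  left : ∀ i ≤ n, a i ∉ R ∧ a i ≠ c ∧ ¬ G.Adj (a i) c
  right : ∀ i ≤ n, b i ∉ R ∧ b i ≠ c ∧ ¬ G.Adj (b i) c
  notMem : c ∉ R
  tips : Tips G B (a n) (b n) c
  card_left : #(outNbrs G B (a n)) = 1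
  card_right : #(outNbrs G B (b n)) = 1
  card_apex : #(outNbrs G B c) = 2

variable {R B Z : Finset V} {n : ℕ} {a b : ℕ → V} {c : V}

namespace LadderState

theorem symm (h : LadderState G R n a b c B) : LadderState G R n b a c B where
  isLadder := h.isLadder.symm
  mem_iff v := by simpa only [or_comm] using h.mem_iff v
  left := h.right
  right := h.left
  notMem := h.notMem
  tips := h.tips.swap
  card_left := h.card_right
  card_right := h.card_left
  card_apex := h.card_apex

theorem left_mem (h : LadderState G R n a b c B) {i : ℕ} (hi : i ≤ n) : a i ∈ B :=
  (h.mem_iff _).2 (Or.inr (Or.inl ⟨i, hi, Or.inl rfl⟩))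

theorem region_subset (h : LadderState G R n a b c B) : R ⊆ B :=
  fun _ hv => (h.mem_iff _).2 (Or.inl hv)

/-- How the vertices of the first row see a new neighbour of `a n`. -/
theorem left_adj (h : LadderState G R n a b c B) {a' : V} (ha : outNbrs G B (a n) = {a'})
    {x : V} (hx : x ∉ B) {i : ℕ} (hi : i ≤ n) : a i ≠ x ∧ (G.Adj (a i) x ↔ i = n ∧ x = a') := by
  refine ⟨fun h1 => hx (h1 ▸ h.left_mem hi), fun h1 => ?_, ?_⟩
  · have hin : i = n := by
      rcases h.tips.eq_of_adj (h.left_mem hi) hx h1 with h2 | h2 | h2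
      · exact h.isLadder.inj_left _ hi _ le_rfl h2
      · exact absurd h2 (h.isLadder.ne _ hi _ le_rfl)
      · exact absurd h2 (h.left i hi).2.1
    subst hin
    exact ⟨rfl, (adj_iff_of_outNbrs ha hx).1 h1⟩
  · rintro ⟨rfl, rfl⟩
    exact (outNbrs_singleton ha).1

theorem extend_isLadder (h : LadderState G R n a b c B) {a' b' : V}
    (ha : outNbrs G B (a n) = {a'}) (hb : outNbrs G B (b n) = {b'}) (hne : a' ≠ b')
    (hadj : G.Adj a' b') :
    IsLadder G (n + 1) (Function.update a (n + 1) a') (Function.update b (n + 1) b') := by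
  have ha' := (outNbrs_singleton ha).2
  have hb' := (outNbrs_singleton hb).2
  refine h.isLadder.extend hadj (fun i hi => ?_) fun i hi => ?_
  · have h1 := h.left_adj ha ha' hi
    have h2 := h.left_adj ha hb' hi
    refine ⟨h1.1, h2.1, by simp [h1.2], by simp [h2.2, hne.symm]⟩
  · have h1 := h.symm.left_adj hb ha' hi
    have h2 := h.symm.left_adj hb hb' hi
    refine ⟨h1.1, h2.1, by simp [h2.2], by simp [h1.2, hne]⟩

/-- The new ends use up two edges each, on the old rung and the new one, so each keeps one outer
neighbour. Nothing changes at `c`. -/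
theorem extend (h : LadderState G R n a b c B) (hG : G.IsRegularOfDegree 3) {a' b' : V}
    (ha : outNbrs G B (a n) = {a'}) (hb : outNbrs G B (b n) = {b'}) (hne : a' ≠ b')
    (hadj : G.Adj a' b') (hac : ¬ G.Adj a' c) (hbc : ¬ G.Adj b' c) :
    LadderState G R (n + 1) (Function.update a (n + 1) a') (Function.update b (n + 1) b') c
      (insert b' (insert a' B)) := by
  have ha' := outNbrs_singleton ha
  have hb' := outNbrs_singleton hb
  have hba : ¬ G.Adj (b n) a' := fun h1 => hne ((adj_iff_of_outNbrs hb ha'.2).1 h1)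
  have hb1 : outNbrs G (insert a' B) (b n) = {b'} := by
    rw [outNbrs_insert, hb, erase_eq_of_notMem (by simpa using hne)]
  have hb'1 := (outNbrs_singleton hb1).2
  have ht1 := h.tips.advance ha
  have ht2 := ht1.swap.advance hb1
  have hc1 := h.tips.card_outNbrs_advance hG ha
  have hc2 := ht1.swap.card_outNbrs_advance hG hb1
  rw [if_neg hba, if_neg fun h1 => hac h1.symm] at hc1
  rw [if_pos hadj, if_neg fun h1 => hbc h1.symm] at hc2
  have hc3 := card_outNbrs_insert (G := G) (v := a') hb'1
  rw [if_pos hadj] at hc3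
  have hc4 := card_outNbrs_insert (G := G) (v := c) ha'.2
  have hc5 := card_outNbrs_insert (G := G) (v := c) hb'1
  rw [if_neg fun h1 => hac h1.symm, h.card_apex] at hc4
  rw [if_neg fun h1 => hbc h1.symm] at hc5
  have hcB := h.tips.mem_right
  refine ⟨h.extend_isLadder ha hb hne hadj, fun v => ?_, ?_, ?_, h.notMem, ?_, ?_, ?_, ?_⟩
  · rw [exists_update, mem_insert, mem_insert, h.mem_iff]
    generalize (∃ i ≤ n, v = a i ∨ v = b i) = P
    tauto
  · exact forall_update (P := fun _ v => v ∉ R ∧ v ≠ c ∧ ¬ G.Adj v c) h.left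
      ⟨fun h1 => ha'.2 (h.region_subset h1), fun h1 => ha'.2 (h1 ▸ hcB), hac⟩
  · exact forall_update (P := fun _ v => v ∉ R ∧ v ≠ c ∧ ¬ G.Adj v c) h.right
      ⟨fun h1 => hb'.2 (h.region_subset h1), fun h1 => hb'.2 (h1 ▸ hcB), hbc⟩
  · simpa using ht2.swap
  · rw [Function.update_self]
    omega
  · rw [Function.update_self]
    omega
  · omega

/-- The ladder stops here. After `a'` is added, the tips `a'`, `b n`, `c` have one outer neighbour
each. If these coincide, `a'` and the common vertex form the last rung of a `T` with apex `c`; if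
they are distinct, `a'` and `c` are the pendant path of an `M`. -/
theorem continues_of_adj (h : LadderState G R n a b c B) (hG : G.IsRegularOfDegree 3)
    (hF : Forces G Z) (hZ : Z ⊆ B) {a' : V} (ha : outNbrs G B (a n) = {a'})
    (hac : G.Adj a' c) (hba : ¬ G.Adj (b n) a') : Continues G R {a 0, b 0, c} := by
  have ha' := outNbrs_singleton ha
  obtain ⟨b', hb⟩ := card_eq_one.1 h.card_right
  have hb' := outNbrs_singleton hb
  have hne : a' ≠ b' := by rintro rfl; exact hba hb'.1
  have hb1 : outNbrs G (insert a' B) (b n) = {b'} := by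
    rw [outNbrs_insert, hb, erase_eq_of_notMem (by simpa using hne)]
  have ht := h.tips.advance ha
  have hc1 := h.tips.card_outNbrs_advance hG ha
  rw [if_neg hba, if_pos hac.symm] at hc1
  have hc2 := card_outNbrs_insert (G := G) (v := c) ha'.2
  rw [if_pos hac.symm, h.card_apex] at hc2
  obtain ⟨x, hx⟩ := card_eq_one.1 (show #(outNbrs G (insert a' B) a') = 1 by omega)
  obtain ⟨z, hz⟩ := card_eq_one.1 (show #(outNbrs G (insert a' B) c) = 1 by omega)
  have hcB := h.tips.mem_right
  rcases ht.eq_or_distinct hG hF (hZ.trans (subset_insert _ _)) hx hb1 hz with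
    ⟨rfl, rfl, huniv⟩ | ⟨hxy, hxz, hyz⟩
  · left
    have hxc := (outNbrs_singleton hz).1.symm
    have hxne : x ≠ c := hxc.ne
    have hlad := h.extend_isLadder ha hb hne (outNbrs_singleton hx).1
    have h1 := forall_update (x := a') (P := fun i v => v ≠ c ∧ (G.Adj v c ↔ i = n + 1))
      (fun i hi => ⟨(h.left i hi).2.1, iff_of_false (h.left i hi).2.2 (by omega)⟩)
      ⟨fun h1 => ha'.2 (h1 ▸ hcB), iff_of_true hac rfl⟩
    have h2 := forall_update (x := x) (P := fun i v => v ≠ c ∧ (G.Adj v c ↔ i = n + 1))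
      (fun i hi => ⟨(h.right i hi).2.1, iff_of_false (h.right i hi).2.2 (by omega)⟩)
      ⟨hxne, iff_of_true hxc rfl⟩
    refine ⟨n + 1, hlad.embeddingT h1 h2, fun v => ?_, ?_⟩
    · refine mem_range_mapT.trans ?_
      rw [exists_update]
      have h3 : v ∈ insert x (insert a' B) := huniv ▸ mem_univ v
      rw [mem_insert, mem_insert, h.mem_iff] at h3
      constructor
      · rintro ((⟨i, hi, rfl | rfl⟩ | rfl | rfl) | rfl)
        · exact (h.left i hi).1
        · exact (h.right i hi).1
        · exact fun h4 => ha'.2 (h.region_subset h4)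
        · exact fun h4 => hb'.2 (h.region_subset h4)
        · exact h.notMem
      · generalize (∃ i ≤ n, v = a i ∨ v = b i) = P at h3 ⊢
        tauto
    · refine image_mapT_attach.trans ?_
      simp
  · right
    have h1 : ∀ i ≤ n, a i ≠ a' ∧ a i ≠ c ∧ (G.Adj (a i) a' ↔ i = n) ∧ ¬ G.Adj (a i) c := by
      intro i hi
      have h1 := h.left_adj ha ha'.2 hi
      exact ⟨h1.1, (h.left i hi).2.1, by simp [h1.2], (h.left i hi).2.2⟩
    have h2 : ∀ i ≤ n, b i ≠ a' ∧ b i ≠ c ∧ ¬ G.Adj (b i) a' ∧ ¬ G.Adj (b i) c := by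
      intro i hi
      have h1 := h.symm.left_adj hb ha'.2 hi
      exact ⟨h1.1, (h.right i hi).2.1, by simp [h1.2, hne], (h.right i hi).2.2⟩
    have hmem : ∀ v, v ∈ insert a' B ↔ v ∈ R ∨ v ∈ Set.range (mapM n a b a' c) := by
      intro v
      rw [mem_insert, h.mem_iff, mem_range_mapM]
      generalize (∃ i ≤ n, v = a i ∨ v = b i) = P
      tauto
    have hout : ∀ v, v ∉ R → v ∉ Set.range (mapM n a b a' c) → v ∉ insert a' B := by
      intro v h3 h4
      rw [hmem]
      tauto
    have hnot : ∀ v, v ∉ insert a' B → v ∉ R ∧ v ∉ Set.range (mapM n a b a' c) := by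
      intro v h3
      rw [hmem] at h3
      tauto
    -- The outer neighbours of the white vertices `b n`, `a'`, `c` are `b'`, `x`, `z`. On the rest
    -- of the ladder the constant `b'` is a dummy value.
    refine ⟨n, h.isLadder.embeddingM hac h1 h2, ?_, image_mapM_attach,
      mapM n (fun _ => b') (fun _ => b') x z, ?_, ?_, ?_, ?_⟩
    · intro t
      have h3 : mapM n a b a' c t ∈ Set.range (mapM n a b a' c) := ⟨t, rfl⟩
      change mapM n a b a' c t ∉ R
      rcases mem_range_mapM.1 h3 with ⟨i, hi, h4 | h4⟩ | h4 | h4 <;> rw [h4]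
      · exact (h.left i hi).1
      · exact (h.right i hi).1
      · exact fun h4 => ha'.2 (h.region_subset h4)
      · exact h.notMem
    · rw [graphM.white_eq]
      rintro _ (rfl | rfl | rfl) _ (rfl | rfl | rfl) <;> intro h3
      · rfl
      · exact absurd h3.symm hxy
      · exact absurd h3 hyz
      · exact absurd h3 hxy
      · rfl
      · exact absurd h3 hxz
      · exact absurd h3.symm hyz
      · exact absurd h3.symm hxz
      · rfl
    · rw [graphM.white_eq]
      rintro _ (rfl | rfl | rfl)
      · exact hnot _ (outNbrs_singleton hb1).2
      · exact hnot _ (outNbrs_singleton hx).2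
      · exact hnot _ (outNbrs_singleton hz).2
    · intro v h3 h4 u hu h5
      have hu' : u ∈ insert a' B := (hmem u).2 (Or.inl hu)
      rcases ht.eq_of_adj hu' (hout v h3 h4) h5 with rfl | rfl | rfl
      · exact ha'.2 (h.region_subset hu)
      · exact (h.right n le_rfl).1 hu
      · exact h.notMem hu
    · intro t v h3 h4
      have hv := hout v h3 h4
      change G.Adj (mapM n a b a' c t) v ↔ _
      have hlad : ∀ s, G.Adj (ladderMap n a b s) v ↔ s = (1, Fin.last n) ∧ v = b' := by
        intro s
        constructor
        · intro h5
          have h6 : ladderMap n a b s ∈ insert a' B := (hmem _).2 (Or.inr ⟨graphM.lad s, rfl⟩)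
          have h7 : ladderMap n a b s = b n := by
            rcases ht.eq_of_adj h6 hv h5 with h7 | h7 | h7
            · exact absurd h7 ((ladderMap_forall (P := fun v => v ≠ a')).2
                (fun i hi => ⟨(h1 i hi).1, (h2 i hi).1⟩) s)
            · exact h7
            · exact absurd h7 ((ladderMap_forall (P := fun v => v ≠ c)).2
                (fun i hi => ⟨(h1 i hi).2.1, (h2 i hi).2.1⟩) s)
          refine ⟨h.isLadder.ladderMap_injective (h7.trans ?_), ?_⟩
          · simp [ladderMap]
          · rw [h7] at h5
            exact (adj_iff_of_outNbrs hb1 hv).1 h5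
        · rintro ⟨rfl, rfl⟩
          simpa [ladderMap] using hb'.1
      revert t
      rw [graphM.forall_iff]
      simp only [graphM.white_eq, Set.mem_insert_iff, Set.mem_singleton_iff, mapM_lad, mapM_mid,
        mapM_tip, graphM.lad_inj, graphM.lad_ne_mid, graphM.lad_ne_tip, true_or, or_true, or_false,
        true_and]
      refine ⟨fun s => ?_, adj_iff_of_outNbrs hx hv, adj_iff_of_outNbrs hz hv⟩
      rw [hlad]
      simp [ladderMap]

/-- Induction on the number of vertices outside `B`: each further rung lowers it, and every case
other than a new rung or an edge to `c` contradicts forcing. -/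
theorem continues (hG : G.IsRegularOfDegree 3) (hF : Forces G Z) : ∀ (k : ℕ) {n : ℕ}
    {a b : ℕ → V} {B : Finset V}, #Bᶜ = k → LadderState G R n a b c B → Z ⊆ B →
    Continues G R {a 0, b 0, c} := by
  intro k
  induction k using Nat.strong_induction_on with
  | _ k ih =>
  rintro n a b B rfl h hZ
  obtain ⟨a', ha⟩ := card_eq_one.1 h.card_left
  obtain ⟨b', hb⟩ := card_eq_one.1 h.card_right
  have ha' := outNbrs_singleton ha
  have hb' := outNbrs_singleton hb
  have hca := card_outNbrs_insert (G := G) (v := c) ha'.2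
  rw [h.card_apex] at hca
  have hcb := card_outNbrs_insert (G := G) (v := b n) ha'.2
  rw [h.card_right] at hcb
  have ht1 := h.tips.advance ha
  have hc1 := h.tips.card_outNbrs_advance hG ha
  have hcut1 := ht1.cutSize_eq
  have hZ1 : Z ⊆ insert a' B := hZ.trans (subset_insert _ _)
  -- If the two ends met at `a'`, an edge to `c` would leave a cut of one. Without that edge, `a'`
  -- has a single outer neighbour `w`; then `w` is adjacent to `c`, giving a cut of two, or both
  -- have two outer neighbours and nothing forces.
  by_cases hne : a' = b'
  · exfalso
    subst hne
    rw [if_pos hb'.1] at hcb hc1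
    by_cases hac : G.Adj c a'
    · rw [if_pos hac] at hca hc1
      have := hF.cutSize_eq_zero_and_eq_univ hG hZ1 (by omega)
      omega
    · rw [if_neg hac] at hca hc1
      obtain ⟨w, hw⟩ := card_eq_one.1 (show #(outNbrs G (insert a' B) a') = 1 by omega)
      have hw' := outNbrs_singleton hw
      have ht2 := ht1.advance hw
      have hc2 := ht1.card_outNbrs_advance hG hw
      have hcut2 := ht2.cutSize_eq
      have hcb2 := card_outNbrs_insert (G := G) (v := b n) hw'.2
      have hca2 := card_outNbrs_insert (G := G) (v := c) hw'.2
      have hZ2 := hZ1.trans (subset_insert w _)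
      have hbw : ¬ G.Adj (b n) w := by
        intro h1
        rw [if_pos h1] at hcb2
        omega
      rw [if_neg hbw] at hcb2 hc2
      by_cases hcw : G.Adj c w
      · rw [if_pos hcw] at hca2 hc2
        have := hF.cutSize_eq_zero_and_eq_univ hG hZ2 (by omega)
        omega
      · rw [if_neg hcw] at hca2 hc2
        have := ht2.eq_univ hF hZ2 (by omega) (by omega) (by omega)
        omega
  have hba : ¬ G.Adj (b n) a' := fun h1 => hne ((adj_iff_of_outNbrs hb ha'.2).1 h1)
  have hab : ¬ G.Adj (a n) b' := fun h1 => hne ((adj_iff_of_outNbrs ha hb'.2).1 h1).symm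
  by_cases hac : G.Adj a' c
  · exact h.continues_of_adj hG hF hZ ha hac hba
  by_cases hbc : G.Adj b' c
  · rw [Set.insert_comm]
    exact h.symm.continues_of_adj hG hF hZ hb hbc hab
  by_cases hadj : G.Adj a' b'
  · have h1 := ih _ (card_lt_card ?_) rfl (h.extend hG ha hb hne hadj hac hbc)
      (hZ1.trans (subset_insert _ _))
    · simpa using h1
    · refine compl_ssubset_compl.2 ⟨(subset_insert _ _).trans (subset_insert _ _), fun h1 => ?_⟩
      exact hb'.2 (h1 (mem_insert_self _ _))
  -- Here `a'`, `b'` and `c` would each have two outer neighbours, so no force is possible.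
  · exfalso
    have hb1 : outNbrs G (insert a' B) (b n) = {b'} := by
      rw [outNbrs_insert, hb, erase_eq_of_notMem (by simpa using hne)]
    have hb'1 := (outNbrs_singleton hb1).2
    have ht2 := ht1.swap.advance hb1
    have hc2 := ht1.swap.card_outNbrs_advance hG hb1
    have hc3 := card_outNbrs_insert (G := G) (v := a') hb'1
    have hc5 := card_outNbrs_insert (G := G) (v := c) hb'1
    rw [if_neg hba, if_neg fun h1 => hac h1.symm] at hc1
    rw [if_neg hadj, if_neg fun h1 => hbc h1.symm] at hc2
    rw [if_neg hadj] at hc3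
    rw [if_neg fun h1 => hac h1.symm] at hca
    rw [if_neg fun h1 => hbc h1.symm] at hc5
    have := ht2.eq_univ hF (hZ1.trans (subset_insert _ _)) (by omega) (by omega) (by omega)
    have := ht2.cutSize_eq
    omega

end LadderState

/-- The vertices outside `R` with a neighbour in `R` are `x`, `y`, `z`, and each of them has exactly
one such neighbour. -/
structure Boundary (G : SimpleGraph V) [DecidableRel G.Adj] (R : Finset V) (x y z : V) : Prop where
  ne₁₂ : x ≠ y
  ne₁₃ : x ≠ z
  ne₂₃ : y ≠ z
  notMem₁ : x ∉ R
  notMem₂ : y ∉ R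
  notMem₃ : z ∉ R
  card₁ : #(G.neighborFinset x ∩ R) = 1
  card₂ : #(G.neighborFinset y ∩ R) = 1
  card₃ : #(G.neighborFinset z ∩ R) = 1
  eq_of_adj : ∀ u ∈ R, ∀ v ∉ R, G.Adj u v → v = x ∨ v = y ∨ v = z

namespace Boundary

variable {x y z : V}

theorem rotate (h : Boundary G R x y z) : Boundary G R y z x where
  ne₁₂ := h.ne₂₃
  ne₁₃ := h.ne₁₂.symm
  ne₂₃ := h.ne₁₃.symm
  notMem₁ := h.notMem₂
  notMem₂ := h.notMem₃
  notMem₃ := h.notMem₁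
  card₁ := h.card₂
  card₂ := h.card₃
  card₃ := h.card₁
  eq_of_adj u hu v hv huv := by
    have := h.eq_of_adj u hu v hv huv
    tauto

theorem tips (h : Boundary G R x y z) : Tips G (insert x (insert y (insert z R))) x y z := by
  refine ⟨by simp, by simp, by simp, h.ne₁₂, h.ne₁₃, h.ne₂₃, fun v hv h1 h2 h3 => ?_⟩
  have hvR : v ∈ R := by simpa [h1, h2, h3] using hv
  refine eq_empty_of_forall_notMem fun w hw => ?_
  simp only [mem_outNbrs, mem_insert, not_or] at hw
  have := h.eq_of_adj v hvR w hw.2.2.2.2 hw.1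
  tauto

theorem card_outNbrs (h : Boundary G R x y z) (hG : G.IsRegularOfDegree 3) :
    #(outNbrs G (insert x (insert y (insert z R))) x) + (if G.Adj x y then 1 else 0) +
      (if G.Adj x z then 1 else 0) = 2 := by
  have h1 := card_outNbrs_self hG R x
  rw [h.card₁] at h1
  have h2 := card_outNbrs_insert (G := G) (v := x) (w := z) (B := insert x R)
    (by simp [h.ne₁₃.symm, h.notMem₃])
  have h3 := card_outNbrs_insert (G := G) (v := x) (w := y) (B := insert z (insert x R))
    (by simp [h.ne₁₂.symm, h.ne₂₃, h.notMem₂])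
  rw [insert_rotate] at h3
  omega

/-- Decided by the edges from `z` to `x` and `y`: both give `T₀`, one gives a cut of two, none
starts a ladder with `c = z`. The set `Z` need only lie in the enlarged region, because initially
`R` is the single vertex `u`. -/
theorem continues_of_adj (h : Boundary G R x y z) (hG : G.IsRegularOfDegree 3) (hF : Forces G Z)
    (hZ : Z ⊆ insert x (insert y (insert z R))) (hxy : G.Adj x y) :
    Continues G R {x, y, z} := by
  have h1 := h.card_outNbrs hG
  have h2 := h.rotate.card_outNbrs hG
  have h3 := h.rotate.rotate.card_outNbrs hG
  have ht := h.tips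
  have hc := ht.cutSize_eq
  rw [insert_rotate] at h2
  rw [insert_rotate, insert_rotate] at h3
  simp only [G.adj_comm y x, G.adj_comm z x, G.adj_comm z y, if_pos hxy] at h1 h2 h3
  have hlad : IsLadder G 0 (fun _ => x) fun _ => y := by
    refine ⟨?_, ?_, ?_, ?_, ?_, ?_⟩ <;> intro i hi j hj <;> obtain rfl := Nat.le_zero.1 hi <;>
      obtain rfl := Nat.le_zero.1 hj
    · simp
    · simp
    · exact h.ne₁₂
    · simp
    · simp
    · simp [hxy]
  have hmem : ∀ v, v ∈ insert x (insert y (insert z R)) ↔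
      v ∈ R ∨ (∃ i ≤ 0, v = (fun _ : ℕ => x) i ∨ v = (fun _ : ℕ => y) i) ∨ v = z := by
    intro v
    have h0 : (∃ i : ℕ, i ≤ 0 ∧ (v = x ∨ v = y)) ↔ (v = x ∨ v = y) :=
      ⟨fun ⟨_, _, h⟩ => h, fun h => ⟨0, le_rfl, h⟩⟩
    simp only [mem_insert]
    rw [h0]
    tauto
  by_cases hxz : G.Adj x z
  · by_cases hyz : G.Adj y z
    · rw [if_pos hxz] at h1 h3
      rw [if_pos hyz] at h2 h3
      have huniv := (hF.cutSize_eq_zero_and_eq_univ hG hZ (by omega)).2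
      refine Or.inl ⟨0, hlad.embeddingT (c := z)
        (fun i hi => ⟨h.ne₁₃, iff_of_true hxz (by omega)⟩)
        (fun i hi => ⟨h.ne₂₃, iff_of_true hyz (by omega)⟩), fun v => ?_, image_mapT_attach⟩
      refine mem_range_mapT.trans ?_
      have h4 := (hmem v).1 (huniv ▸ mem_univ v)
      constructor
      · rintro (⟨i, hi, rfl | rfl⟩ | rfl)
        · exact h.notMem₁
        · exact h.notMem₂
        · exact h.notMem₃
      · exact h4.resolve_left
    · rw [if_pos hxz] at h1 h3
      rw [if_neg hyz] at h2 h3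
      have := hF.cutSize_eq_zero_and_eq_univ hG hZ (by omega)
      omega
  · by_cases hyz : G.Adj y z
    · rw [if_neg hxz] at h1 h3
      rw [if_pos hyz] at h2 h3
      have := hF.cutSize_eq_zero_and_eq_univ hG hZ (by omega)
      omega
    · rw [if_neg hxz] at h1 h3
      rw [if_neg hyz] at h2 h3
      refine LadderState.continues (a := fun _ => x) (b := fun _ => y) hG hF _ rfl
        ⟨hlad, hmem, fun i _ => ⟨h.notMem₁, h.ne₁₃, hxz⟩, fun i _ => ⟨h.notMem₂, h.ne₂₃, hyz⟩,
          h.notMem₃, ht, by omega, by omega, by omega⟩ hZ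

theorem continues (h : Boundary G R x y z) (hG : G.IsRegularOfDegree 3) (hF : Forces G Z)
    (hZ : Z ⊆ insert x (insert y (insert z R))) : Continues G R {x, y, z} := by
  have hrot : ∀ x y z : V, ({y, z, x} : Set V) = {x, y, z} := by
    intro x y z
    ext v
    simp only [Set.mem_insert_iff, Set.mem_singleton_iff]
    tauto
  by_cases hxy : G.Adj x y
  · exact h.continues_of_adj hG hF hZ hxy
  by_cases hyz : G.Adj y z
  · have := h.rotate.continues_of_adj hG hF (by rwa [insert_rotate]) hyz
    rwa [hrot] at this
  by_cases hzx : G.Adj z x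
  · have := h.rotate.rotate.continues_of_adj hG hF (by rwa [insert_rotate, insert_rotate]) hzx
    rwa [hrot, hrot] at this
  -- Three independent boundary vertices have two outer neighbours each, and nothing forces.
  exfalso
  have h1 := h.card_outNbrs hG
  have h2 := h.rotate.card_outNbrs hG
  have h3 := h.rotate.rotate.card_outNbrs hG
  have ht := h.tips
  have hc := ht.cutSize_eq
  rw [insert_rotate] at h2
  rw [insert_rotate, insert_rotate] at h3
  simp only [G.adj_comm y x, G.adj_comm z y, hxy, hyz, hzx, G.adj_comm x z, if_false] at h1 h2 h3
  have := ht.eq_univ hF hZ (by omega) (by omega) (by omega)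
  omega

end Boundary

end Phase

/-! ### Assembling the pieces into a cone or a chain. -/

section Assembly

variable {V : Type*} {G : SimpleGraph V} {K H : ColoredGraph}

/-- Induced copies of the two factors, with the right edges between them, give an induced copy of a
compound. -/
def compoundEmbedding {f : K.white ≃ H.attach} (φ : K.graph ↪g G) (ψ : H.graph ↪g G)
    (hne : ∀ x y, φ x ≠ ψ y)
    (hadj : ∀ x y, G.Adj (φ x) (ψ y) ↔ ∃ h : x ∈ K.white, y = f ⟨x, h⟩) :
    (K.compound H f).graph ↪g G where
  toFun v := Sum.elim φ ψ v
  inj' := φ.injective.sumElim ψ.injective hne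
  map_rel_iff' := by
    have key : ∀ x y, G.Adj (Sum.elim φ ψ x) (Sum.elim φ ψ y) ↔
        (K.compound H f).graph.Adj x y := by
      rintro (x | x) (y | y)
      · exact φ.map_adj_iff.trans ColoredGraph.compound_adj_left.symm
      · exact (hadj x y).trans ColoredGraph.compound_adj_left_right.symm
      · exact (G.adj_comm _ _).trans <| (hadj y x).trans <|
          ColoredGraph.compound_adj_left_right.symm.trans (SimpleGraph.adj_comm _ _ _)
      · exact ψ.map_adj_iff.trans ColoredGraph.compound_adj_right.symm
    exact fun {a b} => key a b

/-- An induced copy of a graph and a vertex adjacent to its attachment vertices give an induced copy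
of the cone. -/
def coneEmbedding (u : V) (ψ : H.graph ↪g G) (hne : ∀ y, u ≠ ψ y)
    (hadj : ∀ y, G.Adj u (ψ y) ↔ y ∈ H.attach) : H.cone.graph ↪g G where
  toFun v := Sum.elim (fun _ : Unit => u) ψ v
  inj' := Function.Injective.sumElim (fun _ _ _ => rfl) ψ.injective fun _ => hne
  map_rel_iff' := by
    have key : ∀ x y, G.Adj (Sum.elim (fun _ : Unit => u) ψ x) (Sum.elim (fun _ : Unit => u) ψ y) ↔
        H.cone.graph.Adj x y := by
      rintro (x | x) (y | y)
      · exact iff_of_false (G.irrefl) (SimpleGraph.irrefl _)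
      · exact (hadj y).trans ColoredGraph.cone_adj_apex.symm
      · exact (G.adj_comm _ _).trans <| (hadj x).trans <|
          ColoredGraph.cone_adj_apex.symm.trans (SimpleGraph.adj_comm _ _ _)
      · exact ψ.map_adj_iff.trans ColoredGraph.cone_adj.symm
    exact fun {a b} => key a b

theorem nonempty_iso_of_surjective {W : Type*} {H : SimpleGraph W} (φ : H ↪g G)
    (h : Function.Surjective φ) : Nonempty (G ≃g H) :=
  ⟨SimpleGraph.Iso.symm ⟨Equiv.ofBijective φ ⟨φ.injective, h⟩, φ.map_rel_iff⟩⟩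

/-- The induced copy `φ` of `K` in `G` has exactly three edges leaving it, joining the white
vertices `t` to distinct vertices `g t`. -/
structure IsPrefix (φ : K.graph ↪g G) (g : K.V → V) : Prop where
  ncard_white : K.white.ncard = 3
  injOn : Set.InjOn g K.white
  notMem : ∀ t ∈ K.white, g t ∉ Set.range φ
  adj : ∀ t, ∀ v ∉ Set.range φ, (G.Adj (φ t) v ↔ t ∈ K.white ∧ v = g t)

/-- White vertices (via `g`) and attachment vertices (via `ψ`) both biject with the same set of
vertices of `G`; composing gives the bijection of the compound. -/
theorem exists_white_equiv_attach {φ : K.graph ↪g G} {g : K.V → V} (h : IsPrefix φ g)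
    (ψ : H.graph ↪g G) (hψ : ψ '' H.attach = g '' K.white) :
    ∃ f : K.white ≃ H.attach, ∀ t, ψ (f t) = g t := by
  have h1 : Set.BijOn g K.white (g '' K.white) := h.injOn.bijOn_image
  have h2 : Set.BijOn ψ H.attach (g '' K.white) := hψ ▸ ψ.injective.injOn.bijOn_image
  refine ⟨(h1.equiv g).trans (h2.equiv ψ).symm, fun t => ?_⟩
  exact congrArg Subtype.val ((h2.equiv ψ).apply_symm_apply (h1.equiv g t))

theorem IsPrefix.adj_iff {φ : K.graph ↪g G} {g : K.V → V} (h : IsPrefix φ g)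
    {ψ : H.graph ↪g G} (hne : ∀ t, ψ t ∉ Set.range φ) {f : K.white ≃ H.attach}
    (hf : ∀ t, ψ (f t) = g t) (x : K.V) (y : H.V) :
    G.Adj (φ x) (ψ y) ↔ ∃ h : x ∈ K.white, y = f ⟨x, h⟩ := by
  rw [h.adj x _ (hne y)]
  constructor
  · rintro ⟨h1, h2⟩
    exact ⟨h1, ψ.injective (h2.trans (hf ⟨x, h1⟩).symm)⟩
  · rintro ⟨h1, rfl⟩
    exact ⟨h1, hf _⟩

theorem graphM.ncard_white (n : ℕ) : (graphM n).white.ncard = 3 := by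
  rw [Set.ncard_eq_three]
  exact ⟨_, _, _, graphM.lad_ne_mid, graphM.lad_ne_tip, graphM.mid_ne_tip, graphM.white_eq⟩

variable [Fintype V] [DecidableEq V] [DecidableRel G.Adj]

theorem IsPrefix.boundary {φ : K.graph ↪g G} {g : K.V → V} (h : IsPrefix φ g) {R : Finset V}
    (hR : ∀ v, v ∈ R ↔ v ∈ Set.range φ) :
    ∃ x y z, Boundary G R x y z ∧ g '' K.white = {x, y, z} := by
  obtain ⟨s, t, r, hst, hsr, htr, hw⟩ := Set.ncard_eq_three.1 h.ncard_white
  have hs : s ∈ K.white := by simp [hw]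
  have ht : t ∈ K.white := by simp [hw]
  have hr : r ∈ K.white := by simp [hw]
  have hcard : ∀ s ∈ K.white, #(G.neighborFinset (g s) ∩ R) = 1 := by
    intro s hs
    rw [card_eq_one]
    refine ⟨φ s, ?_⟩
    ext v
    simp only [mem_inter, SimpleGraph.mem_neighborFinset, mem_singleton, hR]
    constructor
    · rintro ⟨h1, t, rfl⟩
      obtain ⟨h2, h3⟩ := (h.adj t _ (h.notMem s hs)).1 h1.symm
      rw [h.injOn hs h2 h3]
    · rintro rfl
      exact ⟨((h.adj s _ (h.notMem s hs)).2 ⟨hs, rfl⟩).symm, s, rfl⟩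
  refine ⟨g s, g t, g r, ⟨fun h1 => hst (h.injOn hs ht h1), fun h1 => hsr (h.injOn hs hr h1),
    fun h1 => htr (h.injOn ht hr h1), fun h1 => h.notMem s hs ((hR _).1 h1),
    fun h1 => h.notMem t ht ((hR _).1 h1), fun h1 => h.notMem r hr ((hR _).1 h1),
    hcard s hs, hcard t ht, hcard r hr, ?_⟩, ?_⟩
  · intro u hu v hv huv
    obtain ⟨x, rfl⟩ := (hR u).1 hu
    obtain ⟨h1, rfl⟩ := (h.adj x v fun h1 => hv ((hR _).2 h1)).1 huv
    rw [hw] at h1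
    rcases h1 with rfl | rfl | rfl <;> simp
  · rw [hw, Set.image_insert_eq, Set.image_insert_eq, Set.image_singleton]

/-- The family of all `K₁ ▲ M_{n₁} ⊎ … ⊎ M_{n_t}`. -/
def prefixFamily (n₁ : ℕ) (ns : List ℕ) : Set ColoredGraph :=
  ns.foldl (fun S n => ColoredGraph.compoundFamily S (graphM n)) {(graphM n₁).cone}

theorem compound_mem_prefixFamily {n₁ : ℕ} {ns : List ℕ} (hK : K ∈ prefixFamily n₁ ns) (n : ℕ)
    (f : K.white ≃ (graphM n).attach) :
    K.compound (graphM n) f ∈ prefixFamily n₁ (ns ++ [n]) := by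
  unfold prefixFamily
  rw [List.foldl_append]
  exact ⟨K, hK, f, rfl⟩

theorem compound_mem_chainFamily {n₁ : ℕ} {ns : List ℕ} (hK : K ∈ prefixFamily n₁ ns) (m : ℕ)
    (f : K.white ≃ (graphT m).attach) : K.compound (graphT m) f ∈ chainFamily n₁ ns m :=
  ⟨K, hK, f, rfl⟩

/-- Induction on the number of vertices outside the copy: an `Mₙ` lengthens the prefix, and a `Tₘ`
makes the embedding surjective. -/
theorem IsPrefix.exists_chain (hG : G.IsRegularOfDegree 3) {Z : Finset V} (hF : Forces G Z) :
    ∀ (k : ℕ) {K : ColoredGraph} {n₁ : ℕ} {ns : List ℕ} {φ : K.graph ↪g G} {g : K.V → V},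
      (Set.range φ)ᶜ.ncard = k → K ∈ prefixFamily n₁ ns → IsPrefix φ g →
      (∀ v ∈ Z, v ∈ Set.range φ) →
      ∃ (n₁ : ℕ) (ns : List ℕ) (m : ℕ), ∃ H ∈ chainFamily n₁ ns m, Nonempty (G ≃g H.graph) := by
  intro k
  induction k using Nat.strong_induction_on with
  | _ k ih =>
  rintro K n₁ ns φ g rfl hK h hZ
  obtain ⟨R, hR⟩ : ∃ R : Finset V, ∀ v, v ∈ R ↔ v ∈ Set.range φ := by
    classical
    exact ⟨(Set.range φ).toFinset, fun v => Set.mem_toFinset⟩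
  obtain ⟨x, y, z, hbd, hw⟩ := h.boundary hR
  have hZR : Z ⊆ insert x (insert y (insert z R)) := by
    intro v hv
    simp [(hR v).2 (hZ v hv)]
  have hcont := hbd.continues hG hF hZR
  rw [← hw] at hcont
  rcases hcont with ⟨m, ψ, hrange, hS⟩ | ⟨n, ψ, hdisj, hS, g', hinj, hg', hno, hadj⟩
  · obtain ⟨f, hf⟩ := exists_white_equiv_attach h ψ hS
    have hne : ∀ t, ψ t ∉ Set.range φ := fun t h1 => (hrange _).1 ⟨t, rfl⟩ ((hR _).2 h1)
    refine ⟨n₁, ns, m, _, compound_mem_chainFamily hK m f, nonempty_iso_of_surjective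
      (compoundEmbedding φ ψ (fun x y h1 => hne y ⟨x, h1⟩) (h.adj_iff hne hf)) fun v => ?_⟩
    by_cases hv : v ∈ R
    · obtain ⟨t, ht⟩ := (hR v).1 hv
      exact ⟨ColoredGraph.inLeft f t, ht⟩
    · obtain ⟨t, ht⟩ := (hrange v).2 hv
      exact ⟨ColoredGraph.inRight f t, ht⟩
  · obtain ⟨f, hf⟩ := exists_white_equiv_attach h ψ hS
    have hne : ∀ t, ψ t ∉ Set.range φ := fun t h1 => hdisj t ((hR _).2 h1)
    set χ := compoundEmbedding φ ψ (fun x y h1 => hne y ⟨x, h1⟩) (h.adj_iff hne hf) with hχ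
    have hrange : ∀ v, v ∈ Set.range χ ↔ v ∈ Set.range φ ∨ v ∈ Set.range ψ := by
      intro v
      constructor
      · rintro ⟨t | t, rfl⟩
        · exact Or.inl ⟨t, rfl⟩
        · exact Or.inr ⟨t, rfl⟩
      · rintro (⟨t, rfl⟩ | ⟨t, rfl⟩)
        · exact ⟨ColoredGraph.inLeft f t, rfl⟩
        · exact ⟨ColoredGraph.inRight f t, rfl⟩
    -- Only the right factor has white vertices in the compound, so the values of `g` on the left no
    -- longer matter.
    refine ih _ ?_ (φ := χ) (g := fun v => Sum.elim g g' v) rfl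
      (compound_mem_prefixFamily hK n f) ?_ fun v hv => (hrange v).2 (Or.inl (hZ v hv))
    · refine Set.ncard_lt_ncard ?_
      refine ⟨fun v hv h1 => hv ((hrange v).2 (Or.inl h1)), fun h1 => ?_⟩
      exact h1 (hne (graphM.mid n)) ((hrange _).2 (Or.inr ⟨_, rfl⟩))
    · refine ⟨?_, ?_, ?_, ?_⟩
      · exact (Set.ncard_image_of_injective _ Sum.inr_injective).trans (graphM.ncard_white n)
      · rintro _ ⟨s, hs, rfl⟩ _ ⟨t, ht, rfl⟩ hst
        exact congrArg Sum.inr (hinj hs ht hst)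
      · rintro _ ⟨s, hs, rfl⟩ h1
        rcases (hrange _).1 h1 with h2 | h2
        · exact (hg' s hs).1 ((hR _).2 h2)
        · exact (hg' s hs).2 h2
      · rw [ColoredGraph.compound_forall_iff]
        refine ⟨fun t v hv => iff_of_false ?_ fun h1 => ColoredGraph.inLeft_notMem_white h1.1,
          fun t v hv => ?_⟩
        · rw [hrange, not_or, ← hR] at hv
          exact hno v hv.1 hv.2 _ ((hR _).2 ⟨t, rfl⟩)
        · rw [hrange, not_or, ← hR] at hv
          rw [ColoredGraph.inRight_mem_white]
          exact hadj t v hv.1 hv.2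

/-- A vertex making the first force has exactly one neighbour outside `Z`, hence two inside. This
gives both the lower bound three and the shape of `Z` in the extremal case. -/
theorem Forces.exists_star {Z : Finset V} (hG : G.IsRegularOfDegree 3) (hF : Forces G Z)
    (hZ : Z ≠ univ) : ∃ u, insert u (G.neighborFinset u ∩ Z) ⊆ Z ∧
      #(insert u (G.neighborFinset u ∩ Z)) = 3 := by
  obtain ⟨u, hu, w, hw, huw, hout⟩ := hF.exists_force subset_rfl hZ
  refine ⟨u, insert_subset hu inter_subset_right, ?_⟩
  have h1 : #(G.neighborFinset u \ Z) + #(G.neighborFinset u ∩ Z) = 3 := by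
    rw [card_sdiff_add_card_inter, G.card_neighborFinset_eq_degree, hG u]
  have h2 : #(G.neighborFinset u \ Z) = 1 := by
    rw [card_eq_one]
    exact ⟨w, hout⟩
  rw [card_insert_of_notMem (by simp)]
  omega

theorem four_le_card {V : Type*} [Fintype V] {G : SimpleGraph V} [DecidableRel G.Adj]
    (hG : G.IsRegularOfDegree 3) (v : V) : 4 ≤ Fintype.card V := by
  have := G.degree_lt_card_verts v
  rw [hG v] at this
  omega

theorem three_le_card_of_forces [Nonempty V] (hG : G.IsRegularOfDegree 3) {Z : Finset V}
    (hF : Forces G Z) : 3 ≤ #Z := by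
  by_cases hZ : Z = univ
  · have := four_le_card hG (Classical.arbitrary V)
    rw [hZ, card_univ]
    omega
  · obtain ⟨u, h1, h2⟩ := hF.exists_star hG hZ
    rw [← h2]
    exact card_le_card h1

theorem exists_cone_or_chain (hG : G.IsRegularOfDegree 3) {Z : Finset V} (hF : Forces G Z)
    (hcard : #Z = 3) :
    (∃ m : ℕ, Nonempty (G ≃g (graphT m).cone.graph)) ∨
      (∃ (n₁ : ℕ) (ns : List ℕ) (m : ℕ), ∃ H ∈ chainFamily n₁ ns m,
        Nonempty (G ≃g H.graph)) := by
  have hZ : Z ≠ univ := by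
    rintro rfl
    obtain ⟨v, -⟩ := card_pos.1 (show 0 < #(univ : Finset V) by omega)
    have := four_le_card hG v
    rw [card_univ] at hcard
    omega
  obtain ⟨u, h1, h2⟩ := hF.exists_star hG hZ
  have hZu := eq_of_subset_of_card_le h1 (by omega)
  obtain ⟨x, y, z, hxy, hxz, hyz, hN⟩ := card_eq_three.1
    ((G.card_neighborFinset_eq_degree u).trans (hG u))
  have hadj : ∀ v, G.Adj u v ↔ v = x ∨ v = y ∨ v = z := by
    intro v
    rw [← SimpleGraph.mem_neighborFinset, hN]
    simp
  have hone : ∀ v, G.Adj u v → v ∉ ({u} : Finset V) ∧ #(G.neighborFinset v ∩ {u}) = 1 := by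
    intro v hv
    refine ⟨by simpa using hv.ne', card_eq_one.2 ⟨u, ?_⟩⟩
    ext w
    simp only [mem_inter, SimpleGraph.mem_neighborFinset, mem_singleton]
    exact ⟨fun h => h.2, fun h => ⟨h ▸ hv.symm, h⟩⟩
  have hx := hone x ((hadj x).2 (by simp))
  have hy := hone y ((hadj y).2 (by simp))
  have hz := hone z ((hadj z).2 (by simp))
  have hbd : Boundary G {u} x y z := by
    refine ⟨hxy, hxz, hyz, hx.1, hy.1, hz.1, hx.2, hy.2, hz.2, fun w hw v _ hwv => ?_⟩
    rw [mem_singleton.1 hw] at hwv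
    exact (hadj v).1 hwv
  have hZ' : Z ⊆ insert x (insert y (insert z {u})) := by
    rw [← hZu]
    intro v hv
    simp only [mem_insert, mem_inter, SimpleGraph.mem_neighborFinset, hadj] at hv
    simp only [mem_insert, mem_singleton]
    tauto
  have hattach : ∀ {H : ColoredGraph} (ψ : H.graph ↪g G), ψ '' H.attach = {x, y, z} →
      ∀ t, G.Adj u (ψ t) ↔ t ∈ H.attach := by
    intro H ψ hψ t
    rw [hadj, ← ψ.injective.mem_set_image (s := H.attach), hψ]
    simp
  rcases hbd.continues hG hF hZ' with
    ⟨m, ψ, hrange, hS⟩ | ⟨n, ψ, hdisj, hS, g', hinj, hg', hno, hadj'⟩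
  · left
    have hne : ∀ t, u ≠ ψ t := fun t h => (hrange _).1 ⟨t, rfl⟩ (by simp [← h])
    refine ⟨m, nonempty_iso_of_surjective (coneEmbedding u ψ hne (hattach ψ hS)) fun v => ?_⟩
    by_cases hv : v = u
    · exact ⟨ColoredGraph.coneApex _, hv.symm⟩
    · obtain ⟨t, ht⟩ := (hrange v).2 (by simpa using hv)
      exact ⟨ColoredGraph.toCone t, ht⟩
  · right
    have hne : ∀ t, u ≠ ψ t := fun t h => hdisj t (by simp [← h])
    set χ := coneEmbedding u ψ hne (hattach ψ hS) with hχ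
    have hrange : ∀ v, v ∈ Set.range χ ↔ v = u ∨ v ∈ Set.range ψ := by
      intro v
      constructor
      · rintro ⟨t | t, rfl⟩
        · exact Or.inl rfl
        · exact Or.inr ⟨t, rfl⟩
      · rintro (rfl | ⟨t, rfl⟩)
        · exact ⟨ColoredGraph.coneApex _, rfl⟩
        · exact ⟨ColoredGraph.toCone t, rfl⟩
    have hnot : ∀ v, v ∉ Set.range χ → v ∉ ({u} : Finset V) ∧ v ∉ Set.range ψ := by
      intro v hv
      rw [hrange, not_or] at hv
      simpa using hv
    have hpre : IsPrefix (K := (graphM n).cone) χ (fun v => Sum.elim (fun _ : Unit => u) g' v) := by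
      refine ⟨?_, ?_, ?_, ?_⟩
      · exact (Set.ncard_image_of_injective _ Sum.inr_injective).trans (graphM.ncard_white n)
      · rintro _ ⟨s, hs, rfl⟩ _ ⟨t, ht, rfl⟩ hst
        exact congrArg Sum.inr (hinj hs ht hst)
      · rintro _ ⟨s, hs, rfl⟩ h1
        rcases (hrange _).1 h1 with h2 | h2
        · exact (hg' s hs).1 (mem_singleton.2 h2)
        · exact (hg' s hs).2 h2
      · rw [ColoredGraph.cone_forall_iff]
        refine ⟨fun v hv => iff_of_false ?_ fun h1 => ColoredGraph.coneApex_notMem_white h1.1,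
          fun t v hv => ?_⟩
        · exact hno v (hnot v hv).1 (hnot v hv).2 u (mem_singleton_self u)
        · rw [ColoredGraph.toCone_mem_white]
          exact hadj' t v (hnot v hv).1 (hnot v hv).2
    refine IsPrefix.exists_chain hG hF _ rfl (n₁ := n) (ns := []) rfl hpre fun v hv => ?_
    rw [hrange]
    have h3 : v ∈ ψ '' (graphM n).attach ∨ v = u := by
      rw [hS]
      have := hZ' hv
      simp only [mem_insert, mem_singleton] at this
      simp only [Set.mem_insert_iff, Set.mem_singleton_iff]
      tauto
    exact h3.symm.imp id fun ⟨t, _, ht⟩ => ⟨t, ht⟩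

end Assembly

/-! ### The converse: three vertices force every cone and chain. -/

section Spreading

theorem IsForcingClosed.ladder_subset {V : Type*} {G : SimpleGraph V} {B : Set V}
    (hB : IsForcingClosed G B) {n : ℕ} {l : Fin 2 × Fin (n + 1) → V}
    (hl : ∀ x y, (ladder n).Adj x y → G.Adj (l x) (l y)) (h0 : l (0, 0) ∈ B) (h1 : l (1, 0) ∈ B)
    (hN : ∀ x : Fin 2 × Fin (n + 1), x.2 ≠ Fin.last n → ∀ w, G.Adj (l x) w →
      w ∈ B ∨ ∃ y, (ladder n).Adj x y ∧ w = l y) (x : Fin 2 × Fin (n + 1)) : l x ∈ B := by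
  have key : ∀ k : ℕ, ∀ x : Fin 2 × Fin (n + 1), x.2.val ≤ k → l x ∈ B := by
    intro k
    induction k with
    | zero =>
      refine Fin.two_pair_cases (fun _ => h0) (fun _ => h1) fun x hx hx' => ?_
      exact absurd (Fin.ext (Nat.le_zero.1 hx')) hx
    | succ k ih =>
      rintro ⟨i, j⟩ hj
      rcases Nat.le_succ_iff.1 hj with hj | hj
      · exact ih _ hj
      · change j.val = k + 1 at hj
        have hk : k < n + 1 := by omega
        -- Column `k` forces column `k + 1` along each row: every other neighbour is black or in a
        -- column up to `k`.
        refine hB (l (i, ⟨k, hk⟩)) (ih _ le_rfl) _ (hl _ _ ?_) fun w hw hne => ?_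
        · rw [ladder_adj]
          exact Or.inr ⟨rfl, Or.inl hj.symm⟩
        · have hlast : (⟨k, hk⟩ : Fin (n + 1)) ≠ Fin.last n := by
            rw [Ne, Fin.ext_iff, Fin.val_last]
            change k ≠ n
            omega
          rcases hN _ hlast w hw with h | ⟨⟨i', j'⟩, hy, rfl⟩
          · exact h
          · refine ih _ ?_
            rw [ladder_adj] at hy
            rcases hy with ⟨-, h⟩ | ⟨h, h' | h'⟩
            · exact (congrArg Fin.val h).ge
            · refine absurd ?_ hne
              obtain rfl : i = i' := h
              obtain rfl : j' = j := Fin.ext (h'.symm.trans hj.symm)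
              rfl
            · change j'.val + 1 = k at h'
              change j'.val ≤ k
              omega
  exact key _ x le_rfl

/-- In every induced copy of `H` whose non-white vertices have no neighbours outside the copy
except in a black set, black attachment vertices make the whole copy black. -/
def SpreadsFromAttach (V : Type*) (H : ColoredGraph) : Prop :=
  ∀ (G : SimpleGraph V) (ψ : H.graph ↪g G) (B : Set V), IsForcingClosed G B →
    (∀ v ∉ H.white, ∀ w, G.Adj (ψ v) w → w ∈ B ∨ w ∈ Set.range ψ) →
    (∀ v ∈ H.attach, ψ v ∈ B) → ∀ v, ψ v ∈ B

/-- The rungs blacken in order, then the corner `(0, n)` forces `mid`; `tip` is black from the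
start. No white vertex has to force, so neighbours of white vertices outside the copy do no harm. -/
theorem graphM.spreadsFromAttach (V : Type*) (n : ℕ) : SpreadsFromAttach V (graphM n) := by
  intro G ψ B hB hN hatt
  have htip : ψ (tip n) ∈ B := hatt _ (mem_attach.2 (Or.inr (Or.inr rfl)))
  have hlad : ∀ x, ψ (lad x) ∈ B := by
    refine hB.ladder_subset (l := fun x => ψ (lad x)) (fun x y h => ψ.map_adj_iff.2 (adj_lad.2 h))
      (hatt _ (mem_attach.2 (Or.inl rfl))) (hatt _ (mem_attach.2 (Or.inr (Or.inl rfl)))) ?_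
    intro x hx w hw
    have hwhite : lad x ∉ (graphM n).white := by
      rw [white_eq]
      rintro (h | h | h)
      · rw [lad_inj.1 h] at hx
        exact hx rfl
      · exact lad_ne_mid h
      · exact lad_ne_tip h
    rcases hN _ hwhite w hw with h | ⟨y, rfl⟩
    · exact Or.inl h
    · revert y
      rw [forall_iff]
      simp only [ψ.map_adj_iff]
      refine ⟨fun y h => Or.inr ⟨y, adj_lad.1 h, rfl⟩, fun h => ?_, fun h => ?_⟩
      · rw [adj_lad_mid.1 h] at hx
        exact absurd rfl hx
      · exact absurd h not_adj_lad_tip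
  rw [forall_iff]
  refine ⟨hlad, ?_, htip⟩
  have hwhite : lad (0, Fin.last n) ∉ (graphM n).white := by
    rw [white_eq]
    rintro (h | h | h)
    · simp at h
    · exact lad_ne_mid h
    · exact lad_ne_tip h
  refine hB _ (hlad (0, Fin.last n)) _ (ψ.map_adj_iff.2 (adj_lad_mid.2 rfl)) fun w hw hne => ?_
  rcases hN _ hwhite w hw with h | ⟨y, rfl⟩
  · exact h
  · revert y
    rw [forall_iff]
    exact ⟨fun y _ _ => hlad y, fun _ h => absurd rfl h, fun _ _ => htip⟩

theorem graphT.spreadsFromAttach (V : Type*) (n : ℕ) : SpreadsFromAttach V (graphT n) := by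
  intro G ψ B hB hN hatt
  have hapex : ψ (apex n) ∈ B := hatt _ (mem_attach.2 (Or.inr (Or.inr rfl)))
  rw [forall_iff]
  refine ⟨hB.ladder_subset (l := fun x => ψ (lad x))
    (fun x y h => ψ.map_adj_iff.2 (adj_lad.2 h)) (hatt _ (mem_attach.2 (Or.inl rfl)))
    (hatt _ (mem_attach.2 (Or.inr (Or.inl rfl)))) ?_, hapex⟩
  intro x hx w hw
  rcases hN _ (Set.notMem_empty _) w hw with h | ⟨y, rfl⟩
  · exact Or.inl h
  · revert y
    rw [forall_iff]
    simp only [ψ.map_adj_iff]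
    exact ⟨fun y h => Or.inr ⟨y, adj_lad.1 h, rfl⟩, fun h => absurd (adj_lad_apex.1 h) hx⟩

/-- In every induced copy of `K` whose non-white vertices have no neighbours outside the copy,
black vertices `S` make the whole copy black. -/
def SpreadsFrom (V : Type*) (K : ColoredGraph) (S : Set K.V) : Prop :=
  ∀ (G : SimpleGraph V) (φ : K.graph ↪g G) (B : Set V), IsForcingClosed G B →
    (∀ v ∉ K.white, ∀ w, G.Adj (φ v) w → w ∈ Set.range φ) →
    (∀ v ∈ S, φ v ∈ B) → ∀ v, φ v ∈ B

/-- The inclusion of a graph into its cone, as an embedding of graphs. -/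
def ColoredGraph.toConeEmbedding (H : ColoredGraph) : H.graph ↪g H.cone.graph :=
  ⟨⟨toCone, toCone_injective⟩, cone_adj⟩

/-- The inclusion of the left factor into a compound, as an embedding of graphs. -/
def ColoredGraph.inLeftEmbedding {K H : ColoredGraph} (f : K.white ≃ H.attach) :
    K.graph ↪g (K.compound H f).graph :=
  ⟨⟨inLeft f, inLeft_injective⟩, compound_adj_left⟩

/-- The inclusion of the right factor into a compound, as an embedding of graphs. -/
def ColoredGraph.inRightEmbedding {K H : ColoredGraph} (f : K.white ≃ H.attach) :
    H.graph ↪g (K.compound H f).graph :=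
  ⟨⟨inRight f, inRight_injective⟩, compound_adj_right⟩

open ColoredGraph

/-- The apex has just three neighbours, so with two of them black it forces the third. -/
theorem SpreadsFromAttach.cone {V : Type*} {H : ColoredGraph} (hH : SpreadsFromAttach V H)
    {a b c : H.V} (h : ∀ v, v ∈ H.attach ↔ v = a ∨ v = b ∨ v = c) :
    SpreadsFrom V H.cone {H.coneApex, toCone a, toCone b} := by
  intro G φ B hB hN hS
  have hapex : φ H.coneApex ∈ B := hS _ (Or.inl rfl)
  have ha : φ (toCone a) ∈ B := hS _ (Or.inr (Or.inl rfl))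
  have hb : φ (toCone b) ∈ B := hS _ (Or.inr (Or.inr rfl))
  have hc : φ (toCone c) ∈ B := by
    refine hB _ hapex _ (φ.map_adj_iff.2 (cone_adj_apex.2 ((h c).2 (by simp)))) fun w hw hne => ?_
    obtain ⟨y, rfl⟩ := hN _ coneApex_notMem_white w hw
    revert y
    rw [cone_forall_iff]
    refine ⟨fun _ _ => hapex, fun y hy hne => ?_⟩
    rcases (h y).1 (cone_adj_apex.1 (φ.map_adj_iff.1 hy)) with rfl | rfl | rfl
    · exact ha
    · exact hb
    · exact absurd rfl hne
  rw [cone_forall_iff]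
  refine ⟨hapex, hH G (φ.comp H.toConeEmbedding) B hB ?_ ?_⟩
  · intro v hv w hw
    obtain ⟨y, rfl⟩ := hN (toCone v) (fun h1 => hv (toCone_mem_white.1 h1)) w hw
    revert y
    rw [cone_forall_iff]
    exact ⟨fun _ => Or.inl hapex, fun y _ => Or.inr ⟨y, rfl⟩⟩
  · intro v hv
    rcases (h v).1 hv with rfl | rfl | rfl
    · exact ha
    · exact hb
    · exact hc

/-- The left factor blackens by itself, as its non-white vertices have no neighbours beyond it; then
each white `u` has `f u` as its only possibly white neighbour and forces it. Quantifying over all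
ambient graphs in `SpreadsFrom` allows its use for a factor inside a larger copy. -/
theorem SpreadsFrom.compound {V : Type*} {K H : ColoredGraph} {S : Set K.V}
    (hK : SpreadsFrom V K S) (hH : SpreadsFromAttach V H) (f : K.white ≃ H.attach) :
    SpreadsFrom V (K.compound H f) (inLeft f '' S) := by
  intro G φ B hB hN hS
  have hleft : ∀ v, φ (inLeft f v) ∈ B := by
    refine hK G (φ.comp (inLeftEmbedding f)) B hB ?_ fun v hv => hS _ ⟨v, hv, rfl⟩
    intro v hv w hw
    obtain ⟨y, rfl⟩ := hN _ inLeft_notMem_white w hw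
    revert y
    rw [compound_forall_iff]
    refine ⟨fun y _ => ⟨y, rfl⟩, fun y hy => ?_⟩
    exact absurd (compound_adj_left_right.1 (φ.map_adj_iff.1 hy)).1 hv
  rw [compound_forall_iff]
  refine ⟨hleft, hH G (φ.comp (inRightEmbedding f)) B hB ?_ ?_⟩
  · intro v hv w hw
    obtain ⟨y, rfl⟩ := hN (inRight f v) (fun h1 => hv (inRight_mem_white.1 h1)) w hw
    revert y
    rw [compound_forall_iff]
    exact ⟨fun y _ => Or.inl (hleft y), fun y _ => Or.inr ⟨y, rfl⟩⟩
  · intro y hy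
    obtain ⟨u, hu⟩ := f.surjective ⟨y, hy⟩
    have huy : y = f u := by rw [hu]
    refine hB _ (hleft u) _ (φ.map_adj_iff.2 (compound_adj_left_right.2 ⟨u.2, huy⟩))
      fun w hw hne => ?_
    obtain ⟨z, rfl⟩ := hN _ inLeft_notMem_white w hw
    revert z
    rw [compound_forall_iff]
    refine ⟨fun z _ _ => hleft z, fun z hz hne => ?_⟩
    obtain ⟨h1, h2⟩ := compound_adj_left_right.1 (φ.map_adj_iff.1 hz)
    exact absurd (by rw [h2, huy]; rfl) hne

theorem exists_spreadsFrom_cone (V : Type*) {H : ColoredGraph} (hH : SpreadsFromAttach V H)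
    {a b c : H.V} (h : ∀ v, v ∈ H.attach ↔ v = a ∨ v = b ∨ v = c) :
    ∃ S : Set H.cone.V, S.Finite ∧ S.ncard ≤ 3 ∧ SpreadsFrom V H.cone S :=
  ⟨_, Set.toFinite _, (Set.ncard_insert_le _ _).trans
    (Nat.succ_le_succ ((Set.ncard_insert_le _ _).trans (by rw [Set.ncard_singleton]))), hH.cone h⟩

theorem exists_spreadsFrom_compoundFamily (V : Type*) {F : Set ColoredGraph}
    (hF : ∀ K ∈ F, ∃ S : Set K.V, S.Finite ∧ S.ncard ≤ 3 ∧ SpreadsFrom V K S) {H : ColoredGraph}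
    (hH : SpreadsFromAttach V H) {K : ColoredGraph} (hK : K ∈ compoundFamily F H) :
    ∃ S : Set K.V, S.Finite ∧ S.ncard ≤ 3 ∧ SpreadsFrom V K S := by
  obtain ⟨L, hL, f, rfl⟩ := hK
  obtain ⟨S, hfin, hcard, hS⟩ := hF L hL
  exact ⟨_, hfin.image _, (Set.ncard_image_le hfin).trans hcard, hS.compound hH f⟩

theorem exists_spreadsFrom_chainFamily (V : Type*) {n₁ : ℕ} {ns : List ℕ} {m : ℕ}
    {K : ColoredGraph} (hK : K ∈ chainFamily n₁ ns m) :
    ∃ S : Set K.V, S.Finite ∧ S.ncard ≤ 3 ∧ SpreadsFrom V K S := by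
  refine exists_spreadsFrom_compoundFamily V ?_ (graphT.spreadsFromAttach V m) hK
  -- The starting family is kept arbitrary because the left fold changes it at every step.
  have key : ∀ (ns : List ℕ) (F : Set ColoredGraph),
      (∀ K ∈ F, ∃ S : Set K.V, S.Finite ∧ S.ncard ≤ 3 ∧ SpreadsFrom V K S) →
      ∀ K ∈ ns.foldl (fun S n => compoundFamily S (graphM n)) F,
        ∃ S : Set K.V, S.Finite ∧ S.ncard ≤ 3 ∧ SpreadsFrom V K S := by
    intro ns
    induction ns with
    | nil => exact fun F hF => hF
    | cons n ns ih =>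
      exact fun F hF => ih _ fun K hK =>
        exists_spreadsFrom_compoundFamily V hF (graphM.spreadsFromAttach V n) hK
  refine key ns _ ?_
  rintro K rfl
  exact exists_spreadsFrom_cone V (graphM.spreadsFromAttach V n₁) fun _ => graphM.mem_attach

theorem zeroForcingNumber_eq_three {V : Type*} [Fintype V] {G : SimpleGraph V}
    [DecidableRel G.Adj] (hG : G.IsRegularOfDegree 3) {K : ColoredGraph}
    (hK : ∃ S : Set K.V, S.Finite ∧ S.ncard ≤ 3 ∧ SpreadsFrom V K S) (hne : Nonempty K.V)
    (e : G ≃g K.graph) : zeroForcingNumber G = 3 := by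
  classical
  obtain ⟨S, hfin, hcard, hS⟩ := hK
  -- The empty graph is vacuously cubic and has zero forcing number zero, so the lower bound needs a
  -- vertex.
  have : Nonempty V := hne.map e.symm
  obtain ⟨Z, hZ⟩ : ∃ Z : Finset V, (Z : Set V) = e.symm '' S :=
    ⟨(hfin.image e.symm).toFinset, by simp⟩
  have hforce : IsZeroForcingSet G (Z : Set V) := by
    refine isZeroForcingSet_of_forall_closed fun B hZB hB => Set.eq_univ_of_forall fun v => ?_
    have := hS G e.symm.toEmbedding B hB (fun _ _ w _ => e.symm.surjective w)
      (fun v hv => hZB (hZ ▸ ⟨v, hv, rfl⟩)) (e v)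
    simpa using this
  have hle : #Z ≤ 3 := by
    rw [← Set.ncard_coe_finset, hZ]
    exact (Set.ncard_image_le hfin).trans hcard
  have hmem : #Z ∈ {k | ∃ Z : Finset V, Z.card = k ∧ IsZeroForcingSet G (Z : Set V)} :=
    ⟨Z, rfl, hforce⟩
  refine le_antisymm ((Nat.sInf_le hmem).trans hle) (le_csInf ⟨_, hmem⟩ ?_)
  rintro _ ⟨Z', rfl, hZ'⟩
  exact three_le_card_of_forces hG hZ'.forces

end Spreading

theorem theorem10 {V : Type*} [Fintype V] (G : SimpleGraph V) [DecidableRel G.Adj]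
    (hG : G.IsRegularOfDegree 3) :
    zeroForcingNumber G = 3 ↔
      (∃ m : ℕ, Nonempty (G ≃g (graphT m).cone.graph)) ∨
      (∃ (n₁ : ℕ) (ns : List ℕ) (m : ℕ), ∃ H ∈ chainFamily n₁ ns m,
        Nonempty (G ≃g H.graph)) := by
  classical
  constructor
  · intro h
    have hne : {k | ∃ Z : Finset V, Z.card = k ∧ IsZeroForcingSet G (Z : Set V)}.Nonempty := by
      -- The infimum of an empty set of naturals is `0`, so the value three shows that a minimum is
      -- attained.
      refine Nat.nonempty_of_sInf_eq_succ (k := 2) h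
    obtain ⟨Z, hZ, hforce⟩ := Nat.sInf_mem hne
    exact exists_cone_or_chain hG hforce.forces (hZ.trans h)
  · rintro (⟨m, ⟨e⟩⟩ | ⟨n₁, ns, m, H, hH, ⟨e⟩⟩)
    · have hS := exists_spreadsFrom_cone V (graphT.spreadsFromAttach V m) fun _ => graphT.mem_attach
      exact zeroForcingNumber_eq_three hG hS ⟨(graphT m).coneApex⟩ e
    · refine zeroForcingNumber_eq_three hG (exists_spreadsFrom_chainFamily V hH) ?_ e
      obtain ⟨K, -, f, rfl⟩ := hH
      exact ⟨ColoredGraph.inRight f (graphT.apex m)⟩
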